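/- A class $\mathcal C$ of permutations consists of a set of permutations of $\{1,\dots,n\}$ for every $n\ge 0$. A cycle of a permutation of $\{1,\dots,n\}$ is trivial if it has the form $(i,i+1,\dots,i+p)$ with $0\le p<n$ and sums taken modulo $n$ (fixed points are included). A permutation is reduced if it has no trivial cycle; in particular, the empty permutation is reduced. A trivial reduction of $\pi$ is obtained by removing one trivial cycle of $\pi$ and relabelling the remaining points by $1,\dots,m$ in increasing order; then $\pi$ is a trivial extension of the result. **Theorem.** Let $\mathcal C$ be closed under trivial reductions and trivial extensions. Let $p(n,k)$ and $r(n,k)$ be the number of all, respectively of all reduced, permutations of $\{1,\dots,n\}$ in $\mathcal C$ having $k$ cycles, and put $P(x,y)=\sum_{n,k}p(n,k)x^ny^k$ and $R(x,y)=\sum_{n,k}r(n,k)x^ny^k$. Let $D(x,y)=\sum_{n,k}d(n,k)x^ny^k$, where $d(n,k)$ is the number of noncrossing partitions of $\{1,\dots,n\}$ with $k$ parts (so $d(0,0)=1$). Then, as formal power series over $\mathbb Q$, $$D(x,y)=\frac{1-x-xy-\sqrt{(x+xy-1)^2-4x^2y}}{2x}+1,$$ where the square root is the one with constant term $1$, and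 $$1+x\cdot\frac{\frac{\partial}{\partial x}D(x,y)}{D(x,y)}=\frac{1-xD(x,y)}{\sqrt{(x+xy-1)^2-4x^2y}}.$$ If $\mathcal C$ does not contain the empty permutation, then $$P(x,y)=R(xD(x,y),y)\left(1+x\cdot\frac{\frac{\partial}{\partial x}D(x,y)}{D(x,y)}\right)=R(xD(x,y),y)\cdot\frac{1-xD(x,y)}{\sqrt{(x+xy-1)^2-4x^2y}}.$$ If $\mathcal C$ contains the empty permutation, then $$P(x,y)=D(x,y)+\bigl(R(xD(x,y),y)-1\bigr)\left(1+x\cdot\frac{\frac{\partial}{\partial x}D(x,y)}{D(x,y)}\right)=D(x,y)+\bigl(R(xD(x,y),y)-1\bigr)\cdot\frac{1-xD(x,y)}{\sqrt{(x+xy-1)^2-4x^2y}}.$$ -/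

import Mathlib

/-!
Permutations of `{1, …, n}` are elements of `Equiv.Perm (Fin n)`; the points are placed on a circle
in their natural order, and `finRotate n` is the circular permutation `i ↦ i + 1` (modulo `n`).
Formal power series in `x, y` are elements of `MvPowerSeries (Fin 2) ℚ`, with `x = X 0`, `y = X 1`.
-/

namespace TrivialCycles

/-- The number of cycles of a permutation, fixed points included. -/
noncomputable def numCycles {n : ℕ} (π : Equiv.Perm (Fin n)) : ℕ :=
  Nat.card (Quotient (Equiv.Perm.SameCycle.setoid π))

/-- `π` has a trivial cycle with underlying set `s`: a cycle `(i, i + 1, …, i + p)`, `0 ≤ p < n`,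
where sums are taken modulo `n`. -/
def IsTrivialCycle {n : ℕ} (π : Equiv.Perm (Fin n)) (s : Set (Fin n)) : Prop :=
  ∃ (i : Fin n) (p : ℕ), p < n ∧
    s = {a | ∃ t ≤ p, a = (finRotate n ^ t) i} ∧
    (∀ t < p, π ((finRotate n ^ t) i) = (finRotate n ^ (t + 1)) i) ∧
    π ((finRotate n ^ p) i) = i

/-- A permutation is reduced if it contains no trivial cycle. In particular the empty permutation
is reduced. -/
def IsReduced {n : ℕ} (π : Equiv.Perm (Fin n)) : Prop :=
  ∀ s : Set (Fin n), ¬ IsTrivialCycle π s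

/-- `π'` is a trivial reduction of `π` (and `π` is a trivial extension of `π'`): `π'` arises from
`π` by removing one trivial cycle and relabelling the remaining points by `1, …, m` in increasing
order. -/
def IsTrivialReduction {m n : ℕ} (π' : Equiv.Perm (Fin m)) (π : Equiv.Perm (Fin n)) : Prop :=
  ∃ e : Fin m ↪o Fin n, IsTrivialCycle π (Set.range e)ᶜ ∧ ∀ k, π (e k) = e (π' k)

/-- A class of permutations: for each `n`, a set of permutations of `{1, …, n}`. -/
abbrev PermClass : Type := (n : ℕ) → Set (Equiv.Perm (Fin n))

/-- The class is closed under trivial reductions and under trivial extensions. -/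
structure PermClass.IsClosed (C : PermClass) : Prop where
  reduction : ∀ {m n : ℕ} (π' : Equiv.Perm (Fin m)) (π : Equiv.Perm (Fin n)),
    IsTrivialReduction π' π → π ∈ C n → π' ∈ C m
  extension : ∀ {m n : ℕ} (π' : Equiv.Perm (Fin m)) (π : Equiv.Perm (Fin n)),
    IsTrivialReduction π' π → π' ∈ C m → π ∈ C n

/-- `p(n, k)`: the number of permutations of `{1, …, n}` in the class having `k` cycles. -/
noncomputable def PermClass.count (C : PermClass) (n k : ℕ) : ℕ :=
  Nat.card {π : Equiv.Perm (Fin n) // π ∈ C n ∧ numCycles π = k}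

/-- `r(n, k)`: the number of reduced permutations of `{1, …, n}` in the class having `k` cycles. -/
noncomputable def PermClass.countReduced (C : PermClass) (n k : ℕ) : ℕ :=
  Nat.card {π : Equiv.Perm (Fin n) // π ∈ C n ∧ IsReduced π ∧ numCycles π = k}

/-- A partition of `{1, …, n}` is noncrossing if there are no two different parts `A`, `B` and
`a < b < a' < b'` with `a, a' ∈ A` and `b, b' ∈ B`. -/
def IsNoncrossing {n : ℕ} (P : Finpartition (Finset.univ : Finset (Fin n))) : Prop :=
  ∀ A ∈ P.parts, ∀ B ∈ P.parts, A ≠ B →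
    ¬ ∃ a ∈ A, ∃ b ∈ B, ∃ a' ∈ A, ∃ b' ∈ B, a < b ∧ b < a' ∧ a' < b'

/-- The number of noncrossing partitions of `{1, …, n}` having `k` parts (the empty set has exactly
one partition, with no parts). -/
noncomputable def countNoncrossing (n k : ℕ) : ℕ :=
  Nat.card {P : Finpartition (Finset.univ : Finset (Fin n)) //
    IsNoncrossing P ∧ P.parts.card = k}

/-- The formal power series `∑ a(n, k) x ^ n y ^ k`. -/
noncomputable def genFun (a : ℕ → ℕ → ℕ) : MvPowerSeries (Fin 2) ℚ :=
  fun d => (a (d 0) (d 1) : ℚ)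

/-- The variable `x`. -/
noncomputable abbrev x : MvPowerSeries (Fin 2) ℚ := MvPowerSeries.X 0

/-- The variable `y`. -/
noncomputable abbrev y : MvPowerSeries (Fin 2) ℚ := MvPowerSeries.X 1

/-- `D(x, y)`, the generating function of noncrossing partitions. -/
noncomputable def D : MvPowerSeries (Fin 2) ℚ := genFun countNoncrossing

/-- `P(x, y)`, the generating function of the class. -/
noncomputable def PermClass.P (C : PermClass) : MvPowerSeries (Fin 2) ℚ := genFun C.count

/-- `R(x, y)`, the generating function of the reduced members of the class. -/
noncomputable def PermClass.R (C : PermClass) : MvPowerSeries (Fin 2) ℚ := genFun C.countReduced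

/-- The substitution `f(x D(x, y), y)`. -/
noncomputable def substXD (f : MvPowerSeries (Fin 2) ℚ) : MvPowerSeries (Fin 2) ℚ :=
  MvPowerSeries.subst ![x * D, y] f

/-- The factor `1 + x (∂D/∂x) / D`. The constant term of `D` is `1`, so `D⁻¹` is its inverse. -/
noncomputable def factor : MvPowerSeries (Fin 2) ℚ :=
  1 + x * (MvPowerSeries.pderiv ℚ 0 D * D⁻¹)

/-- `S` is the formal square root of `f` with constant term `1` (there is at most one such `S`). -/
def IsFormalSqrt (S f : MvPowerSeries (Fin 2) ℚ) : Prop :=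
  MvPowerSeries.constantCoeff S = 1 ∧ S ^ 2 = f

end TrivialCycles

/-! A trivial cycle is either an arc, a cycle on an interval `[i, j)`, or a wrapping cycle on `[c,
n) ∪ [0, b)` with `0 < b < c < n`; a full rotation counts as the arc `[0, n)`. The two kinds are
removed separately.

Arcs are peeled off by their right ends. Let `F_h` enumerate, by `N`, the objects on `N + h` points
with no arc ending at or before `N`. An arc ending at `N + 1` is unique, and removing it leaves an
object counted by `F_h`. Hence `(1 - x + xy) F_h = (1 - x) (P_h + x F_{h+1})`, where `P_h` is the
part of `F_h` free of `x`. If `E = 1 + xE(y + E - 1)`, then `1 - xE + xEy = E(1 - xE)`, so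
substituting `xE` for `x` gives `E F_h(xE, y) = P_h + x E F_{h+1}(xE, y)`. Iteration turns `E
F_0(xE, y)`, built from the arc-free objects, into `∑ x^h P_h`, which enumerates all objects
(`ArcFamily.mul_subst_genFun`).

This is used twice. For noncrossing partitions with interval parts as arcs, only the empty one is
arc-free, so `E = D` (`D_eq`). For the class it gives `P = D A(xD, y)`, with `A` enumerating the
arc-free members. Such a member has at most one wrapping cycle, whose removal leaves a nonempty
arc-free member, so `(1 - x)² (A - R) = x²y (A - ε)`, with `ε` the contribution of the empty
permutation. Substituting `xD` and eliminating `A` gives the formulas, by way of `D S = 1 - xD²` for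
the root `S = 1 + x - xy - 2xD`. -/

namespace TrivialCycles

/-! ### Power series in two variables and the peeling recurrence -/

open MvPowerSeries Finset

/-- The coefficient of `x ^ n * y ^ k`. -/
noncomputable def cf (f : MvPowerSeries (Fin 2) ℚ) (n k : ℕ) : ℚ :=
  coeff (Finsupp.single 0 n + Finsupp.single 1 k) f

theorem exponent_eq (d : Fin 2 →₀ ℕ) :
    d = Finsupp.single 0 (d 0) + Finsupp.single 1 (d 1) := by
  ext i
  fin_cases i <;> simp

theorem cf_ext {f g : MvPowerSeries (Fin 2) ℚ} (h : ∀ n k, cf f n k = cf g n k) : f = g := by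
  ext d
  rw [exponent_eq d]
  exact h _ _

theorem cf_genFun (a : ℕ → ℕ → ℕ) (n k : ℕ) : cf (genFun a) n k = a n k := by
  simp [cf, genFun, coeff_apply]

theorem cf_add (f g : MvPowerSeries (Fin 2) ℚ) (n k : ℕ) :
    cf (f + g) n k = cf f n k + cf g n k := map_add _ _ _

theorem cf_sub (f g : MvPowerSeries (Fin 2) ℚ) (n k : ℕ) :
    cf (f - g) n k = cf f n k - cf g n k := map_sub _ _ _

theorem cf_x_mul_zero (f : MvPowerSeries (Fin 2) ℚ) (k : ℕ) : cf (x * f) 0 k = 0 := by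
  rw [cf, x, X_def, coeff_monomial_mul, if_neg]
  intro h
  simpa using h 0

theorem cf_x_mul_succ (f : MvPowerSeries (Fin 2) ℚ) (n k : ℕ) :
    cf (x * f) (n + 1) k = cf f n k := by
  rw [cf, x, X_def, add_comm n, Finsupp.single_add, add_assoc, coeff_add_monomial_mul, one_mul, cf]

theorem cf_y_mul_zero (f : MvPowerSeries (Fin 2) ℚ) (n : ℕ) : cf (y * f) n 0 = 0 := by
  rw [cf, y, X_def, coeff_monomial_mul, if_neg]
  intro h
  simpa using h 1

theorem cf_y_mul_succ (f : MvPowerSeries (Fin 2) ℚ) (n k : ℕ) :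
    cf (y * f) n (k + 1) = cf f n k := by
  rw [cf, y, X_def, add_comm k, Finsupp.single_add, add_left_comm, coeff_add_monomial_mul, one_mul,
    cf]

theorem cf_one (n k : ℕ) : cf 1 n k = if n = 0 ∧ k = 0 then 1 else 0 := by
  classical
  rw [cf, coeff_one]
  congr 1
  simp only [eq_iff_iff]
  constructor
  · intro h
    exact ⟨by simpa using DFunLike.congr_fun h 0, by simpa using DFunLike.congr_fun h 1⟩
  · rintro ⟨rfl, rfl⟩
    simp

theorem cf_C_mul_y_pow (q : ℚ) (m n k : ℕ) :
    cf (C q * y ^ m) n k = if n = 0 ∧ k = m then q else 0 := by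
  classical
  rw [cf, coeff_C_mul, y, coeff_X_pow]
  have : (Finsupp.single (0 : Fin 2) n + Finsupp.single 1 k = Finsupp.single 1 m) ↔
      n = 0 ∧ k = m := by
    constructor
    · intro h
      exact ⟨by simpa using DFunLike.congr_fun h 0, by simpa using DFunLike.congr_fun h 1⟩
    · rintro ⟨rfl, rfl⟩
      simp
  simp [this]

theorem one_sub_x_mul_ne_zero (f : MvPowerSeries (Fin 2) ℚ) : 1 - x * f ≠ 0 := by
  intro h
  simpa using congrArg constantCoeff h

theorem hasSubst_x_mul (E : MvPowerSeries (Fin 2) ℚ) : HasSubst ![x * E, y] := by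
  apply hasSubst_of_constantCoeff_zero
  intro s
  fin_cases s <;> simp

/-- The equation of the generating function of noncrossing partitions has a solution. -/
theorem exists_eq_one_add_mul : ∃ E : MvPowerSeries (Fin 2) ℚ, E = 1 + x * E * (y + E - 1) := by
  let s : PowerSeries ℚ := PowerSeries.binomialSeries ℚ (1 / 2 : ℚ)
  have hs : s * s = 1 + PowerSeries.X := by
    rw [← PowerSeries.binomialSeries_add]
    have := PowerSeries.binomialSeries_nat (R := ℚ) (A := ℚ) 1
    norm_num at this ⊢
    exact this
  have hs1 : s.constantCoeff = 1 := PowerSeries.binomialSeries_constantCoeff _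
  -- Chosen so that `1 + x * g` is the radicand `(x + xy - 1)² - 4x²y`.
  let g : MvPowerSeries (Fin 2) ℚ := x * (1 + y) ^ 2 - 2 * (1 + y) - 4 * x * y
  have hg : PowerSeries.HasSubst (x * g) := PowerSeries.HasSubst.of_constantCoeff_zero (by simp)
  let S : MvPowerSeries (Fin 2) ℚ := PowerSeries.substAlgHom hg s
  have hS : S * S = 1 + x * g := by
    have h := congrArg (PowerSeries.substAlgHom hg) hs
    rw [map_mul, map_add, map_one, PowerSeries.substAlgHom_X] at h
    exact h
  have hS1 : constantCoeff S = 1 := by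
    have h := PowerSeries.constantCoeff_subst_eq_zero (a := x * g) (by simp) (s - 1) (by simp [hs1])
    rw [← PowerSeries.coe_substAlgHom hg, map_sub, map_one, map_sub, map_one, sub_eq_zero] at h
    exact h
  have hI : (S + 1) * (S + 1)⁻¹ = 1 := MvPowerSeries.mul_inv_cancel _ (by simp [hS1])
  have h2 : (2 : MvPowerSeries (Fin 2) ℚ) * C (1 / 2) = 1 := by
    rw [← map_ofNat C 2, ← map_mul]
    norm_num
  have hx : (4 * x : MvPowerSeries (Fin 2) ℚ) ≠ 0 := by
    rw [← map_ofNat C 4]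
    intro h
    simpa using congrArg (coeff (Finsupp.single 0 1)) h
  generalize (S + 1)⁻¹ = I at hI
  -- The aim is `S = 1 + x - xy - 2xE`. Since `S - 1 = x g / (S + 1)`, the division by `x` can be
  -- carried out explicitly.
  obtain ⟨E, hE2⟩ : ∃ E, 2 * E = 1 - y - g * I :=
    ⟨C (1 / 2) * (1 - y - g * I), by rw [← mul_assoc, h2, one_mul]⟩
  have hSE : S = 1 + x - x * y - 2 * x * E := by
    have h1 : (S + 1) * (S - 1 - x * g * I) = 0 := by linear_combination hS - x * g * hI
    have hne : S + 1 ≠ 0 := by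
      intro h
      simp [h] at hI
    have h3 := (mul_eq_zero.1 h1).resolve_left hne
    linear_combination h3 + x * hE2
  refine ⟨E, mul_left_cancel₀ hx ?_⟩
  rw [hSE] at hS
  linear_combination -hS

/-- The sums over `a` contribute `x y F_h / (1 - x)`, where `F_h` is the series of `V h`; the
identity is cleared of this denominator. -/
theorem peeled_genFun_eq {V : ℕ → ℕ → ℕ → ℕ}
    (h0 : ∀ h N, V (h + 1) N 0 = V h (N + 1) 0)
    (hs : ∀ h N k, V (h + 1) N (k + 1) = V h (N + 1) (k + 1) + ∑ a ∈ range (N + 1), V h a k)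
    (h : ℕ) :
    (1 - x + x * y) * genFun (V h) =
      (1 - x) * (genFun (fun n k => if n = 0 then V h 0 k else 0) + x * genFun (V (h + 1))) := by
  suffices H : genFun (V h) - x * genFun (V h) + x * (y * genFun (V h)) =
      genFun (fun n k => if n = 0 then V h 0 k else 0)
        - x * genFun (fun n k => if n = 0 then V h 0 k else 0) + x * genFun (V (h + 1))
        - x * (x * genFun (V (h + 1))) by
    linear_combination H
  apply cf_ext
  intro n k
  rcases n with _ | _ | n <;> rcases k with _ | k <;>
    simp only [cf_add, cf_sub, cf_x_mul_zero, cf_x_mul_succ, cf_y_mul_zero, cf_y_mul_succ,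
      cf_genFun, h0, hs, sum_range_succ, Nat.cast_add] <;> simp <;> ring

/-- The bound `K` makes the series a polynomial in `y`, so the substitution only has to respect
finite sums. -/
theorem subst_genFun_y {a : MvPowerSeries (Fin 2) ℚ} (v : ℕ → ℕ) (K : ℕ) (hK : ∀ k ≥ K, v k = 0) :
    subst ![x * a, y] (genFun (fun n k => if n = 0 then v k else 0)) =
      genFun (fun n k => if n = 0 then v k else 0) := by
  have hv : genFun (fun n k => if n = 0 then v k else 0) =
      ∑ m ∈ range K, C (v m : ℚ) * y ^ m := by
    apply cf_ext
    intro n k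
    have : cf (∑ m ∈ range K, C (v m : ℚ) * y ^ m) n k =
        ∑ m ∈ range K, cf (C (v m : ℚ) * y ^ m) n k := map_sum _ _ _
    rw [this, cf_genFun]
    simp only [cf_C_mul_y_pow]
    by_cases hn : n = 0
    · by_cases hk : k < K
      · simp [hn, hk]
      · simp [hn, hk, hK k (not_lt.1 hk)]
    · simp [hn]
  rw [hv, ← substAlgHom_apply (hasSubst_x_mul a), map_sum]
  refine sum_congr rfl fun m _ => ?_
  rw [map_mul, map_pow, substAlgHom_X, substAlgHom_apply, subst_C]
  simp

/-- Inverting the removal of all non-wrapping trivial cycles. -/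
theorem mul_subst_peeled {V : ℕ → ℕ → ℕ → ℕ}
    (h0 : ∀ h N, V (h + 1) N 0 = V h (N + 1) 0)
    (hs : ∀ h N k, V (h + 1) N (k + 1) = V h (N + 1) (k + 1) + ∑ a ∈ range (N + 1), V h a k)
    (hfin : ∀ h, ∃ K, ∀ k ≥ K, V h 0 k = 0)
    {E : MvPowerSeries (Fin 2) ℚ} (hE : E = 1 + x * E * (y + E - 1)) :
    E * subst ![x * E, y] (genFun (V 0)) = genFun (fun n k => V n 0 k) := by
  let φ := substAlgHom (R := ℚ) (hasSubst_x_mul E)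
  have hx : φ x = x * E := substAlgHom_X (hasSubst_x_mul E) 0
  have hy : φ y = y := substAlgHom_X (hasSubst_x_mul E) 1
  let P : ℕ → MvPowerSeries (Fin 2) ℚ := fun h => genFun (fun n k => if n = 0 then V h 0 k else 0)
  have hP : ∀ h, φ (P h) = P h := by
    intro h
    obtain ⟨K, hK⟩ := hfin h
    rw [substAlgHom_apply]
    exact subst_genFun_y _ K hK
  have hstep : ∀ h, E * φ (genFun (V h)) = P h + x * (E * φ (genFun (V (h + 1)))) := by
    intro h
    have := congrArg φ (peeled_genFun_eq h0 hs h)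
    simp only [map_mul, map_add, map_sub, map_one, hx, hy] at this
    rw [show genFun (fun n k => if n = 0 then V h 0 k else 0) = P h from rfl, hP] at this
    -- By `hE`, the substituted kernel `1 - xE + xEy` equals `E (1 - xE)`, so `1 - xE` cancels.
    apply mul_left_cancel₀ (one_sub_x_mul_ne_zero E)
    linear_combination this + φ (genFun (V h)) * hE
  have hcf : ∀ n h k, cf (E * φ (genFun (V h))) n k = V (h + n) 0 k := by
    intro n
    induction n with
    | zero =>
      intro h k
      rw [hstep, cf_add, cf_x_mul_zero, cf_genFun]
      simp
    | succ n ih =>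
      intro h k
      rw [hstep, cf_add, cf_x_mul_succ, cf_genFun, ih]
      simp [add_assoc, add_comm 1]
  apply cf_ext
  intro n k
  rw [← substAlgHom_apply (hasSubst_x_mul E), hcf, cf_genFun, zero_add]

end TrivialCycles

/-! ### Families of objects with removable arcs -/

namespace TrivialCycles

open Finset

/-- The number of objects of size `n` and weight `k` none of whose arcs `[i, j)` ends at or before
`N`. -/
noncomputable def arcFreeCount {X : ℕ → Type} (c : ∀ n, X n → ℕ)
    (Arc : ∀ n, X n → ℕ → ℕ → Prop) (n N k : ℕ) : ℕ :=
  Nat.card {z : X n // c n z = k ∧ ∀ i j, i < j → j ≤ N → ¬ Arc n z i j}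

/-- A family of finite types of objects on `{0, …, n - 1}` with distinguished intervals (arcs) that
are pairwise disjoint and can be removed and inserted. -/
structure ArcFamily (X : ℕ → Type) (c : ∀ n, X n → ℕ) (Arc : ∀ n, X n → ℕ → ℕ → Prop) :
    Prop where
  finite : ∀ n, Finite (X n)
  unique : ∀ {n} (z : X n) {a a' j : ℕ}, j ≤ n → a < j → a' < j → Arc n z a j → Arc n z a' j →
    a = a'
  disjoint : ∀ {n} (z : X n) {i j a b : ℕ}, i < j → a < j → j < b → b ≤ n → Arc n z i j →
    ¬ Arc n z a b
  insert : ∀ {m a : ℕ} (l : ℕ), a ≤ m → ∃ Φ : X m → X (m + (l + 1)), Function.Injective Φ ∧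
    (∀ z, c _ (Φ z) = c _ z + 1) ∧
    (∀ z, Arc _ z a (a + (l + 1)) ↔ z ∈ Set.range Φ) ∧
    ∀ z i j, i < j → j ≤ a → (Arc _ (Φ z) i j ↔ Arc _ z i j)

section

variable {X : ℕ → Type} {c : ∀ n, X n → ℕ} {Arc : ∀ n, X n → ℕ → ℕ → Prop}

theorem card_arcFree_and_arc_zero (hX : ArcFamily X c Arc) {n N a : ℕ} (hN : N + 1 ≤ n)
    (ha : a ≤ N) :
    Nat.card {z : X n // (c n z = 0 ∧ ∀ i j, i < j → j ≤ N → ¬ Arc n z i j) ∧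
      Arc n z a (N + 1)} = 0 := by
  obtain ⟨l, rfl⟩ := Nat.exists_eq_add_of_le ha
  obtain ⟨m, rfl⟩ : ∃ m, n = m + (l + 1) := ⟨n - (l + 1), by omega⟩
  obtain ⟨Φ, -, hc, hr, -⟩ := hX.insert (m := m) (a := a) l (by omega)
  rw [Nat.card_eq_zero]
  left
  constructor
  rintro ⟨z, ⟨h1, -⟩, h2⟩
  rw [add_assoc, hr] at h2
  obtain ⟨w, rfl⟩ := h2
  rw [hc] at h1
  omega

/-- Removing the arc `[a, N + 1)` is a bijection: arcs ending at or before `a` are unaffected, and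
`disjoint` forbids an arc ending strictly inside the removed interval. -/
theorem card_arcFree_and_arc_succ (hX : ArcFamily X c Arc) {n N a : ℕ} (k : ℕ) (hN : N + 1 ≤ n)
    (ha : a ≤ N) :
    Nat.card {z : X n // (c n z = k + 1 ∧ ∀ i j, i < j → j ≤ N → ¬ Arc n z i j) ∧
      Arc n z a (N + 1)} = arcFreeCount c Arc (n - (N + 1 - a)) a k := by
  obtain ⟨l, rfl⟩ := Nat.exists_eq_add_of_le ha
  obtain ⟨m, rfl⟩ : ∃ m, n = m + (l + 1) := ⟨n - (l + 1), by omega⟩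
  obtain ⟨Φ, hi, hc, hr, hA⟩ := hX.insert (m := m) (a := a) l (by omega)
  rw [show m + (l + 1) - (a + l + 1 - a) = m by omega, add_assoc a l 1]
  symm
  refine Nat.card_congr (Equiv.ofBijective (fun z => ⟨Φ z.1, ⟨by rw [hc, z.2.1], ?_⟩,
    (hr _).2 ⟨_, rfl⟩⟩) ⟨?_, ?_⟩)
  · intro i j hij hj h
    by_cases hja : j ≤ a
    · exact z.2.2 i j hij hja ((hA _ _ _ hij hja).1 h)
    · exact hX.disjoint _ hij (by omega) (by omega) (by omega) h ((hr _).2 ⟨_, rfl⟩)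
  · intro z w h
    exact Subtype.ext (hi (congrArg Subtype.val h))
  · rintro ⟨z, ⟨h1, h2⟩, h3⟩
    obtain ⟨w, rfl⟩ := (hr _).1 h3
    refine ⟨⟨w, ?_, ?_⟩, rfl⟩
    · rw [hc] at h1
      omega
    · intro i j hij hj h
      exact h2 i j hij (by omega) ((hA _ _ _ hij hj).2 h)

/-- Objects are sorted by the arc ending at `N + 1`, if any; `unique` makes the cases exclusive. -/
theorem arcFreeCount_eq_add_sum (hX : ArcFamily X c Arc) {n N : ℕ} (k : ℕ) (hN : N + 1 ≤ n) :
    arcFreeCount c Arc n N k = arcFreeCount c Arc n (N + 1) k + ∑ a ∈ range (N + 1),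
      Nat.card {z : X n // (c n z = k ∧ ∀ i j, i < j → j ≤ N → ¬ Arc n z i j) ∧
        Arc n z a (N + 1)} := by
  classical
  have := hX.finite n
  have := Fintype.ofFinite (X n)
  simp only [arcFreeCount, Nat.card_eq_fintype_card, Fintype.card_subtype]
  rw [← card_biUnion, ← card_union_of_disjoint]
  · congr 1
    ext z
    simp only [mem_filter, mem_univ, true_and, mem_union, mem_biUnion, mem_range]
    constructor
    · rintro ⟨h1, h2⟩
      by_cases h : ∃ a < N + 1, Arc n z a (N + 1)
      · obtain ⟨a, ha, h⟩ := h
        exact Or.inr ⟨a, ha, ⟨h1, h2⟩, h⟩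
      · push Not at h
        refine Or.inl ⟨h1, fun i j hij hj => ?_⟩
        rcases Nat.lt_or_ge N j with hj' | hj'
        · obtain rfl : j = N + 1 := by omega
          exact h i hij
        · exact h2 i j hij hj'
    · rintro (⟨h1, h2⟩ | ⟨a, ha, h, -⟩)
      · exact ⟨h1, fun i j hij hj => h2 i j hij (by omega)⟩
      · exact h
  · rw [Finset.disjoint_left]
    intro z hz hz'
    simp only [mem_filter, mem_univ, true_and, mem_biUnion, mem_range] at hz hz'
    obtain ⟨a, ha, -, h⟩ := hz'
    exact hz.2 a (N + 1) ha le_rfl h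
  · intro a ha b hb hab
    rw [Function.onFun, Finset.disjoint_left]
    intro z hz hz'
    simp only [mem_filter, mem_univ, true_and] at hz hz'
    simp only [coe_range, Set.mem_Iio] at ha hb
    exact hab (hX.unique z hN ha hb hz.2 hz'.2)

theorem exists_forall_arcFreeCount_eq_zero (hX : ArcFamily X c Arc) (n N : ℕ) :
    ∃ K, ∀ k ≥ K, arcFreeCount c Arc n N k = 0 := by
  have := hX.finite n
  obtain ⟨K, hK⟩ := (Set.finite_range (c n)).bddAbove
  refine ⟨K + 1, fun k hk => ?_⟩
  rw [arcFreeCount, Nat.card_eq_zero]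
  left
  constructor
  rintro ⟨z, h, -⟩
  have := hK ⟨z, rfl⟩
  omega

/-- The generating function of an arc family is obtained from that of its arc-free members by
substituting `x E` for `x` and multiplying by `E`. -/
theorem ArcFamily.mul_subst_genFun (hX : ArcFamily X c Arc)
    {E : MvPowerSeries (Fin 2) ℚ} (hE : E = 1 + x * E * (y + E - 1)) :
    E * MvPowerSeries.subst ![x * E, y] (genFun (fun n k => arcFreeCount c Arc n n k)) =
      genFun (fun n k => arcFreeCount c Arc n 0 k) := by
  -- The index `h` is the number of points to the right of the cut `N`; removing an arc to the left
  -- of the cut preserves it.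
  have h := mul_subst_peeled (V := fun h N k => arcFreeCount c Arc (N + h) N k) ?_ ?_ ?_ hE
  · simpa using h
  · intro h N
    rw [← add_assoc, add_right_comm, arcFreeCount_eq_add_sum hX 0 (by omega), add_eq_left]
    refine sum_eq_zero fun a ha => card_arcFree_and_arc_zero hX (by omega) ?_
    rw [mem_range] at ha
    omega
  · intro h N k
    rw [← add_assoc, add_right_comm, arcFreeCount_eq_add_sum hX (k + 1) (by omega)]
    congr 1
    refine sum_congr rfl fun a ha => ?_
    rw [mem_range] at ha
    rw [card_arcFree_and_arc_succ hX k (by omega) (by omega)]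
    congr 1
    omega
  · intro h
    exact exists_forall_arcFreeCount_eq_zero hX _ _

end

end TrivialCycles

/-! ### Gluing permutations along an interval -/

namespace TrivialCycles

/-- The embedding of `Fin m` into `Fin (m + l)` that leaves out `[a, a + l)`. -/
def skip (m l a : ℕ) (k : Fin m) : Fin (m + l) :=
  ⟨if (k : ℕ) < a then k else k + l, by split <;> omega⟩

/-- The embedding of `Fin l` into `Fin (m + l)` with image `[a, a + l)`. -/
def block {m a : ℕ} (l : ℕ) (ha : a ≤ m) (i : Fin l) : Fin (m + l) :=
  ⟨a + i, by omega⟩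

/-- `Fin (m + l)` is the disjoint union of the interval `[a, a + l)` and its complement. -/
noncomputable def gapEquiv {m a : ℕ} (l : ℕ) (ha : a ≤ m) : Fin m ⊕ Fin l ≃ Fin (m + l) :=
  Equiv.ofBijective (Sum.elim (skip m l a) (block l ha)) (by
    constructor
    · rintro (i | i) (j | j) h <;> simp only [Sum.elim_inl, Sum.elim_inr, skip, block,
        Fin.mk.injEq] at h <;> simp only [reduceCtorEq, Sum.inl.injEq, Sum.inr.injEq, Fin.ext_iff] <;>
        first | omega | (split_ifs at h <;> omega)
    · intro k
      by_cases h1 : (k : ℕ) < a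
      · exact ⟨Sum.inl ⟨k, by omega⟩, by simp [skip, h1]⟩
      · by_cases h2 : (k : ℕ) < a + l
        · exact ⟨Sum.inr ⟨k - a, by omega⟩, by ext; simp [block]; omega⟩
        · refine ⟨Sum.inl ⟨k - l, by omega⟩, ?_⟩
          ext
          simp only [Sum.elim_inl, skip]
          split_ifs <;> omega)

theorem gapEquiv_inl {m a : ℕ} (l : ℕ) (ha : a ≤ m) (k : Fin m) :
    gapEquiv l ha (Sum.inl k) = skip m l a k := rfl

theorem gapEquiv_inr {m a : ℕ} (l : ℕ) (ha : a ≤ m) (i : Fin l) :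
    gapEquiv l ha (Sum.inr i) = block l ha i := rfl

theorem skip_or_block {m a l : ℕ} (ha : a ≤ m) (k : Fin (m + l)) :
    (∃ i, k = skip m l a i) ∨ ∃ i, k = block l ha i := by
  obtain ⟨i | i, rfl⟩ := (gapEquiv l ha).surjective k
  · exact Or.inl ⟨i, rfl⟩
  · exact Or.inr ⟨i, rfl⟩

theorem skip_injective (m l a : ℕ) : Function.Injective (skip m l a) := by
  intro i j h
  simp only [skip, Fin.mk.injEq] at h
  ext
  split_ifs at h <;> omega

theorem block_injective {m a l : ℕ} (ha : a ≤ m) : Function.Injective (block l ha) := by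
  intro i j h
  simp only [block, Fin.mk.injEq] at h
  ext
  omega

theorem skip_ne_block {m a l : ℕ} (ha : a ≤ m) (i : Fin m) (j : Fin l) :
    skip m l a i ≠ block l ha j := by
  intro h
  simp only [skip, block, Fin.mk.injEq] at h
  split_ifs at h <;> omega

/-- The permutation acting by `σ` outside `[a, a + l)` and by `ρ` on `[a, a + l)`. -/
noncomputable def gluePerm {m a : ℕ} (l : ℕ) (ha : a ≤ m) :
    Equiv.Perm (Fin m) × Equiv.Perm (Fin l) →* Equiv.Perm (Fin (m + l)) :=
  (gapEquiv l ha).permCongrHom.toMonoidHom.comp (Equiv.Perm.sumCongrHom _ _)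

section

variable {m a l : ℕ} (ha : a ≤ m) (p : Equiv.Perm (Fin m) × Equiv.Perm (Fin l))

theorem gluePerm_skip (k : Fin m) : gluePerm l ha p (skip m l a k) = skip m l a (p.1 k) := by
  rw [← gapEquiv_inl l ha, ← gapEquiv_inl l ha]
  simp [gluePerm, Equiv.permCongrHom]

theorem gluePerm_block (i : Fin l) : gluePerm l ha p (block l ha i) = block l ha (p.2 i) := by
  rw [← gapEquiv_inr, ← gapEquiv_inr]
  simp [gluePerm, Equiv.permCongrHom]

theorem gluePerm_injective : Function.Injective (gluePerm l ha) :=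
  (gapEquiv l ha).permCongrHom.injective.comp Equiv.Perm.sumCongrHom_injective

/-- A permutation mapping the interval onto itself also preserves the complement. -/
theorem exists_gluePerm_eq_of_block {π : Equiv.Perm (Fin (m + l))} {ρ : Equiv.Perm (Fin l)}
    (h : ∀ i, π (block l ha i) = block l ha (ρ i)) : ∃ σ, gluePerm l ha (σ, ρ) = π := by
  have hm : ∀ k, ∃ k', π (skip m l a k) = skip m l a k' := by
    intro k
    refine (skip_or_block ha _).resolve_right ?_
    rintro ⟨i, hi⟩
    obtain ⟨i, rfl⟩ := ρ.surjective i
    rw [← h] at hi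
    exact skip_ne_block ha _ _ (π.injective hi)
  choose f hf using hm
  have hfi : Function.Injective f := fun i j hij =>
    skip_injective m l a (π.injective (by rw [hf, hf, hij]))
  refine ⟨Equiv.ofBijective f hfi.bijective_of_finite, Equiv.ext fun k => ?_⟩
  obtain ⟨k, rfl⟩ | ⟨k, rfl⟩ := skip_or_block ha k
  · rw [gluePerm_skip, hf]
    rfl
  · rw [gluePerm_block, h]

theorem exists_gluePerm_eq_of_skip {π : Equiv.Perm (Fin (m + l))} {σ : Equiv.Perm (Fin m)}
    (h : ∀ i, π (skip m l a i) = skip m l a (σ i)) : ∃ ρ, gluePerm l ha (σ, ρ) = π := by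
  have hm : ∀ k, ∃ k', π (block l ha k) = block l ha k' := by
    intro k
    refine (skip_or_block ha _).resolve_left ?_
    rintro ⟨i, hi⟩
    obtain ⟨i, rfl⟩ := σ.surjective i
    rw [← h] at hi
    exact skip_ne_block ha _ _ (π.injective hi).symm
  choose f hf using hm
  have hfi : Function.Injective f := fun i j hij =>
    block_injective ha (π.injective (by rw [hf, hf, hij]))
  refine ⟨Equiv.ofBijective f hfi.bijective_of_finite, Equiv.ext fun k => ?_⟩
  obtain ⟨k, rfl⟩ | ⟨k, rfl⟩ := skip_or_block ha k
  · rw [gluePerm_skip, h]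
  · rw [gluePerm_block, hf]
    rfl

end

theorem card_quotient_sum {α β γ : Type*} [Finite γ] (e : α ⊕ β ≃ γ) (r : Setoid γ)
    (s : Setoid α) (t : Setoid β)
    (hs : ∀ i j, r (e (Sum.inl i)) (e (Sum.inl j)) ↔ s i j)
    (ht : ∀ i j, r (e (Sum.inr i)) (e (Sum.inr j)) ↔ t i j)
    (hst : ∀ i j, ¬ r (e (Sum.inl i)) (e (Sum.inr j))) :
    Nat.card (Quotient r) = Nat.card (Quotient s) + Nat.card (Quotient t) := by
  have : Finite (α ⊕ β) := Finite.of_equiv _ e.symm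
  have : Finite α := Finite.of_injective _ (Sum.inl_injective (β := β))
  have : Finite β := Finite.of_injective _ (Sum.inr_injective (α := α))
  rw [← Nat.card_sum]
  symm
  refine Nat.card_congr (Equiv.ofBijective (Sum.elim
    (Quotient.map (fun i => e (Sum.inl i)) fun i j h => (hs i j).2 h)
    (Quotient.map (fun i => e (Sum.inr i)) fun i j h => (ht i j).2 h)) ⟨?_, ?_⟩)
  · rintro (i | i) (j | j) h <;> induction i using Quotient.inductionOn <;>
      induction j using Quotient.inductionOn
    · exact congrArg Sum.inl (Quotient.sound ((hs _ _).1 (Quotient.exact h)))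
    · exact absurd (Quotient.exact h) (hst _ _)
    · exact absurd (Quotient.exact h.symm) (hst _ _)
    · exact congrArg Sum.inr (Quotient.sound ((ht _ _).1 (Quotient.exact h)))
  · intro k
    induction k using Quotient.inductionOn with | _ k =>
    obtain ⟨i | i, rfl⟩ := e.surjective k
    · exact ⟨Sum.inl ⟦i⟧, rfl⟩
    · exact ⟨Sum.inr ⟦i⟧, rfl⟩

theorem numCycles_gluePerm {m a l : ℕ} (ha : a ≤ m)
    (p : Equiv.Perm (Fin m) × Equiv.Perm (Fin l)) :
    numCycles (gluePerm l ha p) = numCycles p.1 + numCycles p.2 := by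
  refine card_quotient_sum (gapEquiv l ha) _ _ _ ?_ ?_ ?_
  · intro i j
    refine exists_congr fun t => ?_
    rw [← map_zpow, gapEquiv_inl, gapEquiv_inl, gluePerm_skip, (skip_injective m l a).eq_iff]
    rfl
  · intro i j
    refine exists_congr fun t => ?_
    rw [← map_zpow, gapEquiv_inr, gapEquiv_inr, gluePerm_block, (block_injective ha).eq_iff]
    rfl
  · rintro i j ⟨t, h⟩
    rw [← map_zpow, gapEquiv_inl, gapEquiv_inr, gluePerm_skip] at h
    exact skip_ne_block ha _ _ h

theorem val_finRotate {n : ℕ} (i : Fin n) :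
    (finRotate n i : ℕ) = if (i : ℕ) + 1 = n then 0 else (i : ℕ) + 1 := by
  cases n with
  | zero => exact i.elim0
  | succ n =>
    rw [coe_finRotate]
    simp [Fin.ext_iff]

theorem val_finRotate_pow {n : ℕ} (i : Fin n) (t : ℕ) :
    ((finRotate n ^ t) i : ℕ) = (i + t) % n := by
  induction t with
  | zero => simp [Nat.mod_eq_of_lt i.2]
  | succ t ih =>
    have := Nat.mod_lt (i + t) i.pos
    rw [pow_succ', Equiv.Perm.mul_apply, val_finRotate, ih, ← add_assoc, ← Nat.mod_add_mod (i + t) n 1]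
    split_ifs with h
    · rw [h, Nat.mod_self]
    · exact (Nat.mod_eq_of_lt (by omega)).symm

theorem numCycles_finRotate (l : ℕ) : numCycles (finRotate (l + 1)) = 1 := by
  rw [numCycles, Nat.card_eq_one_iff_unique]
  refine ⟨⟨fun i j => ?_⟩, ⟨⟦0⟧⟩⟩
  induction i using Quotient.inductionOn with | _ i =>
  induction j using Quotient.inductionOn with | _ j =>
  -- After `l + 1 - i` rotations `i` is at `0`, and `j` more lead to `j`.
  refine Quotient.sound ⟨((l + 1 - i + j : ℕ) : ℤ), ?_⟩
  rw [zpow_natCast]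
  ext
  rw [val_finRotate_pow, show (i : ℕ) + (l + 1 - i + j) = (j : ℕ) + (l + 1) by omega,
    Nat.add_mod_right, Nat.mod_eq_of_lt j.2]

end TrivialCycles

/-! ### Arcs and wrapping arcs of permutations -/

namespace TrivialCycles

/-- `π` restricts to the cycle `(i, i + 1, …, j - 1)`. -/
def IsArc {n : ℕ} (π : Equiv.Perm (Fin n)) (i j : ℕ) : Prop :=
  ∀ k : Fin n, i ≤ k → (k : ℕ) < j → (π k : ℕ) = if (k : ℕ) + 1 = j then i else k + 1

/-- `π` restricts to the cycle `(c, c + 1, …, n - 1, 0, 1, …, b - 1)`. -/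
def IsWrappingArc {n : ℕ} (π : Equiv.Perm (Fin n)) (b c : ℕ) : Prop :=
  ∀ k : Fin n, (k : ℕ) < b ∨ c ≤ k →
    (π k : ℕ) = if (k : ℕ) + 1 = b then c else if (k : ℕ) + 1 = n then 0 else k + 1

theorem mod_eq_ite_of_lt {n s : ℕ} (h : s < n + n) : s % n = if s < n then s else s - n := by
  split_ifs with hs
  · exact Nat.mod_eq_of_lt hs
  · rw [Nat.mod_eq_sub_mod (by omega), Nat.mod_eq_of_lt (by omega)]

theorem IsArc.isTrivialCycle {n : ℕ} {π : Equiv.Perm (Fin n)} {i j : ℕ} (hij : i < j) (hj : j ≤ n)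
    (h : IsArc π i j) : IsTrivialCycle π {k | i ≤ k ∧ (k : ℕ) < j} := by
  have hv : ∀ t, i + t < n → ((finRotate n ^ t) ⟨i, by omega⟩ : ℕ) = i + t := fun t ht => by
    rw [val_finRotate_pow]
    exact Nat.mod_eq_of_lt ht
  refine ⟨⟨i, by omega⟩, j - i - 1, by omega, ?_, ?_, ?_⟩
  · ext k
    constructor
    · rintro ⟨h1, h2⟩
      refine ⟨k - i, by omega, Fin.ext ?_⟩
      rw [hv _ (by omega)]
      omega
    · rintro ⟨t, ht, rfl⟩
      simp only [Set.mem_ofPred_eq]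
      rw [hv _ (by omega)]
      omega
  · intro t ht
    ext
    rw [h _ (by rw [hv _ (by omega)]; omega) (by rw [hv _ (by omega)]; omega), hv _ (by omega),
      hv _ (by omega), if_neg (by omega)]
    omega
  · ext
    rw [h _ (by rw [hv _ (by omega)]; omega) (by rw [hv _ (by omega)]; omega), hv _ (by omega),
      if_pos (by omega)]

theorem IsWrappingArc.isTrivialCycle {n : ℕ} {π : Equiv.Perm (Fin n)} {b c : ℕ} (hb : 0 < b)
    (hbc : b < c) (hc : c < n) (h : IsWrappingArc π b c) :
    IsTrivialCycle π {k | (k : ℕ) < b ∨ c ≤ k} := by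
  have hv : ∀ t, t < n → ((finRotate n ^ t) ⟨c, hc⟩ : ℕ) = if c + t < n then c + t else c + t - n :=
    fun t ht => by
      rw [val_finRotate_pow]
      exact mod_eq_ite_of_lt (by simp only; omega)
  refine ⟨⟨c, hc⟩, n - c + b - 1, by omega, ?_, ?_, ?_⟩
  · ext k
    constructor
    · rintro (h1 | h1)
      · refine ⟨n - c + k, by omega, Fin.ext ?_⟩
        rw [hv _ (by omega), if_neg (by omega)]
        omega
      · refine ⟨k - c, by omega, Fin.ext ?_⟩
        rw [hv _ (by omega), if_pos (by omega)]
        omega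
    · rintro ⟨t, ht, rfl⟩
      simp only [Set.mem_ofPred_eq]
      rw [hv _ (by omega)]
      split_ifs <;> omega
  · intro t ht
    ext
    rw [h _ (by rw [hv _ (by omega)]; split_ifs <;> omega), hv _ (by omega), hv _ (by omega)]
    split_ifs <;> omega
  · ext
    rw [h _ (by rw [hv _ (by omega)]; split_ifs <;> omega), hv _ (by omega), if_pos]
    split_ifs <;> omega

theorem exists_arc_of_isTrivialCycle {n : ℕ} {π : Equiv.Perm (Fin n)} {s : Set (Fin n)}
    (h : IsTrivialCycle π s) :
    (∃ i j, i < j ∧ j ≤ n ∧ IsArc π i j) ∨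
      ∃ b c, 0 < b ∧ b < c ∧ c < n ∧ IsWrappingArc π b c := by
  obtain ⟨i, p, hp, -, h1, h2⟩ := h
  have hv : ∀ t ≤ n, ((finRotate n ^ t) i : ℕ) = if i + t < n then i + t else i + t - n :=
    fun t ht => by
      rw [val_finRotate_pow]
      exact mod_eq_ite_of_lt (by omega)
  -- The cycle condition in coordinates: the value of `π` at `i + t` reduced modulo `n`.
  have key : ∀ k : Fin n, ∀ t ≤ p, (k : ℕ) = (if i + t < n then i + t else i + t - n) →
      (π k : ℕ) = if t = p then (i : ℕ) else if i + (t + 1) < n then i + (t + 1)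
        else i + (t + 1) - n := by
    intro k t ht hk
    obtain rfl : k = (finRotate n ^ t) i := Fin.ext (by rw [hv _ (by omega), hk])
    split_ifs with h3
    · rw [h3, h2]
    · rw [h1 _ (by omega), hv _ (by omega), if_pos (by omega)]
    · rw [h1 _ (by omega), hv _ (by omega), if_neg (by omega)]
  by_cases h3 : i + p < n
  · refine Or.inl ⟨i, i + p + 1, by omega, by omega, fun k hk1 hk2 => ?_⟩
    rw [key k (k - i) (by omega) (by split_ifs <;> omega)]
    split_ifs <;> omega
  · by_cases h4 : p + 1 = n
    · refine Or.inl ⟨0, n, by omega, le_rfl, fun k hk1 hk2 => ?_⟩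
      by_cases h5 : (i : ℕ) ≤ k
      · rw [key k (k - i) (by omega) (by split_ifs <;> omega)]
        split_ifs <;> omega
      · rw [key k (k + n - i) (by omega) (by split_ifs <;> omega)]
        split_ifs <;> omega
    · refine Or.inr ⟨i + p + 1 - n, i, by omega, by omega, by omega, fun k hk => ?_⟩
      by_cases h5 : (i : ℕ) ≤ k
      · rw [key k (k - i) (by omega) (by split_ifs <;> omega)]
        split_ifs <;> omega
      · rw [key k (k + n - i) (by omega) (by split_ifs <;> omega)]
        split_ifs <;> omega

theorem isReduced_iff {n : ℕ} (π : Equiv.Perm (Fin n)) :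
    IsReduced π ↔ (∀ i j, i < j → j ≤ n → ¬ IsArc π i j) ∧
      ∀ b c, 0 < b → b < c → c < n → ¬ IsWrappingArc π b c := by
  constructor
  · intro h
    exact ⟨fun i j hij hj ha => h _ (ha.isTrivialCycle hij hj),
      fun b c hb hbc hc ha => h _ (ha.isTrivialCycle hb hbc hc)⟩
  · rintro ⟨h1, h2⟩ s hs
    obtain ⟨i, j, hij, hj, h⟩ | ⟨b, c, hb, hbc, hc, h⟩ := exists_arc_of_isTrivialCycle hs
    · exact h1 i j hij hj h
    · exact h2 b c hb hbc hc h

theorem PermClass.IsClosed.mem_iff {C : PermClass} (hC : C.IsClosed) {m n : ℕ}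
    {σ : Equiv.Perm (Fin m)} {π : Equiv.Perm (Fin n)} (h : IsTrivialReduction σ π) :
    π ∈ C n ↔ σ ∈ C m :=
  ⟨hC.reduction _ _ h, hC.extension _ _ h⟩

section glue

variable {m a l : ℕ}

theorem val_skip (k : Fin m) :
    (skip m l a k : ℕ) = if (k : ℕ) < a then (k : ℕ) else k + l := rfl

theorem val_block (ha : a ≤ m) (i : Fin l) : (block l ha i : ℕ) = a + i := rfl

theorem skip_strictMono : StrictMono (skip m l a) := by
  intro i j h
  rw [Fin.lt_def] at h ⊢
  rw [val_skip, val_skip]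
  split_ifs <;> omega

theorem block_strictMono (ha : a ≤ m) : StrictMono (block l ha) := by
  intro i j h
  rw [Fin.lt_def] at h ⊢
  rw [val_block, val_block]
  omega

theorem isArc_gluePerm (ha : a ≤ m) (σ : Equiv.Perm (Fin m)) :
    IsArc (gluePerm l ha (σ, finRotate l)) a (a + l) := by
  intro k h1 h2
  obtain ⟨k, rfl⟩ | ⟨k, rfl⟩ := skip_or_block ha k
  · rw [val_skip] at h1 h2
    split_ifs at h1 h2 <;> omega
  · rw [gluePerm_block, val_block, val_block, val_finRotate]
    split_ifs <;> omega

theorem exists_gluePerm_of_isArc (ha : a ≤ m) {π : Equiv.Perm (Fin (m + l))}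
    (h : IsArc π a (a + l)) : ∃ σ, gluePerm l ha (σ, finRotate l) = π := by
  apply exists_gluePerm_eq_of_block
  intro i
  ext
  rw [h _ (by rw [val_block]; omega) (by rw [val_block]; omega), val_block, val_block,
    val_finRotate]
  split_ifs <;> omega

theorem isWrappingArc_gluePerm (ha : a ≤ m) (ha0 : 0 < a) (ham : a < m) (hl : 0 < l)
    (ρ : Equiv.Perm (Fin l)) :
    IsWrappingArc (gluePerm l ha (finRotate m, ρ)) a (a + l) := by
  intro k h1
  obtain ⟨k, rfl⟩ | ⟨k, rfl⟩ := skip_or_block ha k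
  · rw [gluePerm_skip, val_skip, val_skip, val_finRotate]
    split_ifs <;> omega
  · rw [val_block] at h1
    omega

theorem exists_gluePerm_of_isWrappingArc (ha : a ≤ m) (ha0 : 0 < a) (ham : a < m) (hl : 0 < l)
    {π : Equiv.Perm (Fin (m + l))} (h : IsWrappingArc π a (a + l)) :
    ∃ ρ, gluePerm l ha (finRotate m, ρ) = π := by
  apply exists_gluePerm_eq_of_skip
  intro i
  ext
  rw [h _ (by rw [val_skip]; split_ifs <;> omega), val_skip, val_skip, val_finRotate]
  split_ifs <;> omega

theorem isTrivialReduction_gluePerm_skip (ha : a ≤ m) (hl : 0 < l) (σ : Equiv.Perm (Fin m)) :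
    IsTrivialReduction σ (gluePerm l ha (σ, finRotate l)) := by
  refine ⟨OrderEmbedding.ofStrictMono _ (skip_strictMono (a := a)), ?_, ?_⟩
  · convert (isArc_gluePerm (l := l) ha σ).isTrivialCycle (by omega) (by omega) using 1
    ext k
    simp only [OrderEmbedding.coe_ofStrictMono, Set.mem_compl_iff, Set.mem_range, not_exists,
      Set.mem_ofPred_eq]
    obtain ⟨k, rfl⟩ | ⟨k, rfl⟩ := skip_or_block ha k
    · rw [val_skip]
      refine iff_of_false (fun h => h k rfl) ?_
      split_ifs <;> omega
    · rw [val_block]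
      exact iff_of_true (fun i => skip_ne_block ha _ _) (by omega)
  · exact gluePerm_skip ha _

theorem isTrivialReduction_gluePerm_block (ha : a ≤ m) (ha0 : 0 < a) (ham : a < m) (hl : 0 < l)
    (ρ : Equiv.Perm (Fin l)) :
    IsTrivialReduction ρ (gluePerm l ha (finRotate m, ρ)) := by
  refine ⟨OrderEmbedding.ofStrictMono _ (block_strictMono ha), ?_, ?_⟩
  · convert (isWrappingArc_gluePerm ha ha0 ham hl ρ).isTrivialCycle ha0 (by omega) (by omega)
      using 1
    ext k
    simp only [OrderEmbedding.coe_ofStrictMono, Set.mem_compl_iff, Set.mem_range, not_exists,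
      Set.mem_ofPred_eq]
    obtain ⟨k, rfl⟩ | ⟨k, rfl⟩ := skip_or_block ha k
    · rw [val_skip]
      refine iff_of_true (fun i => (skip_ne_block ha _ _).symm) ?_
      split_ifs <;> omega
    · rw [val_block]
      exact iff_of_false (fun h => h k rfl) (by omega)
  · exact gluePerm_block ha _

theorem isArc_gluePerm_iff_of_le (ha : a ≤ m)
    (p : Equiv.Perm (Fin m) × Equiv.Perm (Fin l)) {i j : ℕ} (hij : i < j) (hj : j ≤ a) :
    IsArc (gluePerm l ha p) i j ↔ IsArc p.1 i j := by
  constructor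
  · intro h k hk1 hk2
    have hk : (skip m l a k : ℕ) = k := by rw [val_skip, if_pos (by omega)]
    have := h (skip m l a k) (by omega) (by omega)
    rw [gluePerm_skip, hk, val_skip] at this
    split_ifs at this ⊢ <;> omega
  · intro h k hk1 hk2
    obtain ⟨k, rfl⟩ | ⟨k, rfl⟩ := skip_or_block ha k
    · have hk : (skip m l a k : ℕ) = k := by
        rw [val_skip] at hk2 ⊢
        split_ifs at hk2 ⊢ <;> omega
      have := h k (by omega) (by omega)
      rw [gluePerm_skip, hk, val_skip, this]
      split_ifs <;> omega
    · rw [val_block] at hk2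
      omega

theorem isArc_gluePerm_add_iff (ha : a ≤ m)
    (p : Equiv.Perm (Fin m) × Equiv.Perm (Fin l)) {i j : ℕ} (hij : i < j) (hj : j ≤ l) :
    IsArc (gluePerm l ha p) (a + i) (a + j) ↔ IsArc p.2 i j := by
  constructor
  · intro h k hk1 hk2
    have := h (block l ha k) (by rw [val_block]; omega) (by rw [val_block]; omega)
    rw [gluePerm_block, val_block, val_block] at this
    split_ifs at this ⊢ <;> omega
  · intro h k hk1 hk2
    obtain ⟨k, rfl⟩ | ⟨k, rfl⟩ := skip_or_block ha k
    · rw [val_skip] at hk1 hk2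
      split_ifs at hk1 hk2 <;> omega
    · rw [val_block] at hk1 hk2
      have := h k (by omega) (by omega)
      rw [gluePerm_block, val_block, val_block, this]
      split_ifs <;> omega

end glue

/-- The two arcs would send `j - 1` to `i` and to `j`, respectively. -/
theorem IsArc.not_isArc {n i j a b : ℕ} {π : Equiv.Perm (Fin n)} (hij : i < j) (ha : a < j)
    (hjb : j < b) (hb : b ≤ n) (h : IsArc π i j) : ¬ IsArc π a b := by
  intro h'
  have h1 := h ⟨j - 1, by omega⟩ (by simp only; omega) (by simp only; omega)
  rw [h' _ (by simp only; omega) (by simp only; omega)] at h1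
  simp only at h1
  split_ifs at h1 <;> omega

/-- An arc lies in the gap left by a wrapping arc: otherwise the two prescribe different images of
`j - 1` or of `b - 1`. -/
theorem IsArc.le_of_isWrappingArc {n i j b c : ℕ} {π : Equiv.Perm (Fin n)} (hij : i < j)
    (hj : j ≤ n) (hb : 0 < b) (hbc : b < c) (hc : c < n) (h : IsArc π i j)
    (h' : IsWrappingArc π b c) : b ≤ i ∧ j ≤ c := by
  by_contra hcon
  by_cases h3 : j ≤ b ∨ b ≤ i ∧ c < j
  · have h1 := h ⟨j - 1, by omega⟩ (by simp only; omega) (by simp only; omega)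
    rw [h' _ (by simp only; omega)] at h1
    simp only at h1
    split_ifs at h1 <;> omega
  · have h1 := h ⟨b - 1, by omega⟩ (by simp only; omega) (by simp only; omega)
    rw [h' _ (by simp only; omega)] at h1
    simp only at h1
    split_ifs at h1 <;> omega

/-- The images of the point just before the smaller of `b` and `b'` are compared. -/
theorem IsWrappingArc.unique {n b c b' c' : ℕ} {π : Equiv.Perm (Fin n)} (hb : 0 < b)
    (hbc : b < c) (hc : c < n) (hb' : 0 < b') (hbc' : b' < c') (hc' : c' < n)
    (h : IsWrappingArc π b c) (h' : IsWrappingArc π b' c') : b = b' ∧ c = c' := by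
  rcases Nat.lt_or_ge b' b with hlt | hle
  · have h1 := h ⟨b' - 1, by omega⟩ (by simp only; omega)
    rw [h' _ (by simp only; omega)] at h1
    simp only at h1
    split_ifs at h1 <;> omega
  · have h1 := h ⟨b - 1, by omega⟩ (by simp only; omega)
    rw [h' _ (by simp only; omega)] at h1
    simp only at h1
    split_ifs at h1 <;> omega

theorem arcFamily_permClass {C : PermClass} (hC : C.IsClosed) :
    ArcFamily (fun n => {π : Equiv.Perm (Fin n) // π ∈ C n}) (fun _ π => numCycles π.1)
      (fun _ π => IsArc π.1) where
  finite _ := inferInstance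
  unique := by
    intro n z a a' j hj ha ha' h h'
    have h1 := h ⟨j - 1, by omega⟩ (by simp only; omega) (by simp only; omega)
    rw [h' _ (by simp only; omega) (by simp only; omega)] at h1
    simp only at h1
    split_ifs at h1 <;> omega
  disjoint := by
    intro n z i j a b hij ha hjb hb h
    exact h.not_isArc hij ha hjb hb
  insert := by
    intro m a l ha
    refine ⟨fun σ => ⟨gluePerm (l + 1) ha (σ.1, finRotate (l + 1)),
      (hC.mem_iff (isTrivialReduction_gluePerm_skip ha l.succ_pos σ.1)).2 σ.2⟩, ?_, ?_, ?_, ?_⟩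
    · intro σ τ h
      exact Subtype.ext (Prod.ext_iff.1 (gluePerm_injective ha (congrArg Subtype.val h))).1
    · intro σ
      rw [numCycles_gluePerm, numCycles_finRotate]
    · intro π
      constructor
      · intro h
        obtain ⟨σ, hσ⟩ := exists_gluePerm_of_isArc ha h
        refine ⟨⟨σ, (hC.mem_iff (isTrivialReduction_gluePerm_skip ha l.succ_pos σ)).1 ?_⟩,
          Subtype.ext hσ⟩
        rw [hσ]
        exact π.2
      · rintro ⟨σ, rfl⟩
        exact isArc_gluePerm ha σ.1
    · intro σ i j hij hj
      exact isArc_gluePerm_iff_of_le ha _ hij hj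

end TrivialCycles

/-! ### Wrapping cycles: from arc-free to reduced permutations -/

namespace TrivialCycles

open Finset

/-- The number of permutations of `{0, …, n - 1}` in `C` with `k` cycles and without non-wrapping
trivial cycles. -/
noncomputable def PermClass.arcFree (C : PermClass) (n k : ℕ) : ℕ :=
  arcFreeCount (X := fun n => {π : Equiv.Perm (Fin n) // π ∈ C n}) (fun _ π => numCycles π.1)
    (fun _ π => IsArc π.1) n n k

/-- The number of permutations of `{0, …, n - 1}` in `C` with `k` cycles, no non-wrapping
trivial cycle, and the trivial cycle on `[c, n) ∪ [0, b)`. -/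
noncomputable def PermClass.wrapping (C : PermClass) (n k b c : ℕ) : ℕ :=
  Nat.card {z : {π : Equiv.Perm (Fin n) // π ∈ C n} //
    (numCycles z.1 = k ∧ ∀ i j, i < j → j ≤ n → ¬ IsArc z.1 i j) ∧ IsWrappingArc z.1 b c}

theorem PermClass.wrapping_zero (C : PermClass) {n b c : ℕ} (hb : 0 < b) (hbc : b < c)
    (hc : c < n) : C.wrapping n 0 b c = 0 := by
  obtain ⟨l, rfl⟩ := Nat.exists_eq_add_of_le hbc.le
  obtain ⟨m, rfl⟩ : ∃ m, n = m + 1 + l := ⟨n - l - 1, by omega⟩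
  rw [PermClass.wrapping, Nat.card_eq_zero]
  left
  constructor
  rintro ⟨⟨π, hπ⟩, ⟨h1, -⟩, h2⟩
  obtain ⟨ρ, hρ : _ = π⟩ := exists_gluePerm_of_isWrappingArc (m := m + 1) (by omega) hb (by omega)
    (by omega) h2
  have h3 : numCycles π = 0 := h1
  rw [← hρ, numCycles_gluePerm, numCycles_finRotate] at h3
  omega

/-- Removing the wrapping cycle leaves a permutation of the gap `[b, c)`. All arcs of the original
lie in that gap, so being arc-free passes in both directions. -/
theorem PermClass.IsClosed.wrapping_succ {C : PermClass} (hC : C.IsClosed) {n b c : ℕ} (k : ℕ)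
    (hb : 0 < b) (hbc : b < c) (hc : c < n) : C.wrapping n (k + 1) b c = C.arcFree (c - b) k := by
  obtain ⟨l, rfl⟩ := Nat.exists_eq_add_of_le hbc.le
  obtain ⟨m, rfl⟩ : ∃ m, n = m + 1 + l := ⟨n - l - 1, by omega⟩
  have hl : 0 < l := by omega
  have hbm : b < m + 1 := by omega
  rw [Nat.add_sub_cancel_left]
  symm
  refine Nat.card_congr (Equiv.ofBijective (fun z => ⟨⟨gluePerm l hbm.le (finRotate (m + 1), z.1.1),
    (hC.mem_iff (isTrivialReduction_gluePerm_block hbm.le hb hbm hl _)).2 z.1.2⟩,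
    ⟨?_, ?_⟩, isWrappingArc_gluePerm hbm.le hb hbm hl _⟩) ⟨?_, ?_⟩)
  · have h : numCycles z.1.1 = k := z.2.1
    rw [numCycles_gluePerm, numCycles_finRotate, h, add_comm]
  · intro i j hij hj h
    obtain ⟨h1, h2⟩ := h.le_of_isWrappingArc hij hj hb hbc hc
      (isWrappingArc_gluePerm hbm.le hb hbm hl _)
    obtain ⟨i, rfl⟩ := Nat.exists_eq_add_of_le h1
    obtain ⟨j, rfl⟩ := Nat.exists_eq_add_of_le (h1.trans hij.le)
    exact z.2.2 i j (by omega) (by omega)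
      ((isArc_gluePerm_add_iff hbm.le _ (by omega) (by omega)).1 h)
  · intro z w h
    have h := congrArg (fun u => u.1.1) h
    exact Subtype.ext (Subtype.ext (Prod.ext_iff.1 (gluePerm_injective hbm.le h)).2)
  · rintro ⟨⟨π, hπ⟩, ⟨h1, h2⟩, h3⟩
    obtain ⟨ρ, rfl⟩ := exists_gluePerm_of_isWrappingArc hbm.le hb hbm hl h3
    rw [hC.mem_iff (isTrivialReduction_gluePerm_block hbm.le hb hbm hl _)] at hπ
    refine ⟨⟨⟨ρ, hπ⟩, ?_, ?_⟩, rfl⟩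
    · simp only [numCycles_gluePerm, numCycles_finRotate] at h1
      simp only
      omega
    · intro i j hij hj h
      exact h2 (b + i) (b + j) (by omega) (by omega)
        ((isArc_gluePerm_add_iff hbm.le _ hij hj).2 h)

/-- A wrapping cycle is unique if it exists. The summation index is `d = c - b - 1`, since the
number of remaining points, `d + 1`, is all that the summand will depend on. -/
theorem PermClass.arcFree_eq (C : PermClass) (n k : ℕ) :
    C.arcFree n k = C.countReduced n k +
      ∑ c ∈ range n, ∑ d ∈ range (c - 1), C.wrapping n k (c - (d + 1)) c := by
  classical
  have hR : C.countReduced n k = Nat.card {z : {π : Equiv.Perm (Fin n) // π ∈ C n} //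
      (numCycles z.1 = k ∧ ∀ i j, i < j → j ≤ n → ¬ IsArc z.1 i j) ∧
        ∀ b c, 0 < b → b < c → c < n → ¬ IsWrappingArc z.1 b c} := by
    refine Nat.card_congr ⟨fun z => ⟨⟨z.1, z.2.1⟩, ⟨z.2.2.2, ((isReduced_iff _).1 z.2.2.1).1⟩,
      ((isReduced_iff _).1 z.2.2.1).2⟩, fun z => ⟨z.1.1, z.1.2, (isReduced_iff _).2
      ⟨z.2.1.2, z.2.2⟩, z.2.1.1⟩, fun z => rfl, fun z => rfl⟩
  rw [hR, sum_sigma']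
  simp only [PermClass.arcFree, arcFreeCount, PermClass.wrapping, Nat.card_eq_fintype_card,
    Fintype.card_subtype]
  rw [← card_biUnion, ← card_union_of_disjoint]
  · congr 1
    ext z
    simp only [mem_filter, mem_univ, true_and, mem_union, mem_biUnion, mem_sigma, mem_range,
      Sigma.exists]
    constructor
    · intro h1
      by_cases h : ∀ b c, 0 < b → b < c → c < n → ¬ IsWrappingArc z.1 b c
      · exact Or.inl ⟨h1, h⟩
      · push Not at h
        obtain ⟨b, c, hb, hbc, hc, h⟩ := h
        refine Or.inr ⟨c, c - b - 1, ⟨hc, by omega⟩, h1, ?_⟩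
        rwa [show c - (c - b - 1 + 1) = b by omega]
    · rintro (⟨h, -⟩ | ⟨c, d, -, h, -⟩) <;> exact h
  · rw [Finset.disjoint_left]
    intro z hz hz'
    simp only [mem_filter, mem_univ, true_and, mem_biUnion, mem_sigma, mem_range,
      Sigma.exists] at hz hz'
    obtain ⟨c, d, ⟨hc, hd⟩, -, h⟩ := hz'
    exact hz.2 _ _ (by omega) (by omega) hc h
  · rintro ⟨c, d⟩ hcd ⟨c', d'⟩ hcd' hne
    rw [Function.onFun, Finset.disjoint_left]
    intro z hz hz'
    simp only [mem_filter, mem_univ, true_and] at hz hz'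
    simp only [coe_sigma, Set.mem_sigma_iff, mem_coe, mem_range] at hcd hcd'
    obtain ⟨h1, rfl⟩ := hz.2.unique (by omega) (by omega) (by omega) (by omega) (by omega)
      (by omega) hz'.2
    obtain rfl : d = d' := by omega
    exact hne rfl

theorem PermClass.arcFree_zero_size (C : PermClass) (k : ℕ) :
    C.arcFree 0 k = C.count 0 k := by
  refine Nat.card_congr ⟨fun z => ⟨z.1.1, z.1.2, z.2.1⟩, fun z => ⟨⟨z.1, z.2.1⟩, z.2.2,
    fun i j hij hj => by omega⟩, fun z => rfl, fun z => rfl⟩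

theorem numCycles_of_size_zero (π : Equiv.Perm (Fin 0)) : numCycles π = 0 := by
  rw [numCycles, Nat.card_eq_zero]
  left
  constructor
  intro i
  induction i using Quotient.inductionOn with | _ i => exact i.elim0

open Classical in
theorem PermClass.count_zero_size (C : PermClass) (k : ℕ) :
    C.count 0 k = if (1 : Equiv.Perm (Fin 0)) ∈ C 0 ∧ k = 0 then 1 else 0 := by
  split_ifs with h
  · obtain ⟨h, rfl⟩ := h
    rw [PermClass.count, Nat.card_eq_one_iff_unique]
    exact ⟨⟨fun a b => Subtype.ext (Subsingleton.elim _ _)⟩, ⟨1, h, numCycles_of_size_zero _⟩⟩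
  · rw [PermClass.count, Nat.card_eq_zero]
    left
    constructor
    rintro ⟨π, h1, h2⟩
    rw [numCycles_of_size_zero] at h2
    exact h ⟨Subsingleton.elim π 1 ▸ h1, h2.symm⟩

/-- The coefficient form of multiplication by `(1 - x)²`. -/
theorem sum_sum_wrapping_second_difference (f : ℕ → ℚ) (n : ℕ) :
    (∑ c ∈ range (n + 3), ∑ d ∈ range (c - 1), f (d + 1))
      - 2 * (∑ c ∈ range (n + 2), ∑ d ∈ range (c - 1), f (d + 1))
      + (∑ c ∈ range (n + 1), ∑ d ∈ range (c - 1), f (d + 1)) = f (n + 1) := by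
  rw [sum_range_succ _ (n + 2), sum_range_succ _ (n + 1)]
  simp only [Nat.add_sub_cancel, show n + 2 - 1 = n + 1 by omega]
  rw [sum_range_succ (fun d => f (d + 1)) n]
  ring

open Classical in
theorem PermClass.IsClosed.genFun_reduced {C : PermClass} (hC : C.IsClosed) :
    -- A wrapping cycle leaving `m ≥ 1` points has `n - 1 - m` positions, and `∑ (n - 1 - m) xⁿ`
    -- over `n > m` is `x^(m + 2) / (1 - x)²`. The case `m = 0` is excluded, whence the correction
    -- term.
    (1 - x) ^ 2 * C.R = (1 - x) ^ 2 * genFun C.arcFree - x ^ 2 * y *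
      (genFun C.arcFree - if (1 : Equiv.Perm (Fin 0)) ∈ C 0 then 1 else 0) := by
  have h0 : ∀ n, (C.arcFree n 0 : ℚ) = C.countReduced n 0 := by
    intro n
    rw [C.arcFree_eq, sum_eq_zero, add_zero]
    intro c hc
    refine sum_eq_zero fun d hd => ?_
    rw [mem_range] at hc hd
    exact C.wrapping_zero (by omega) (by omega) hc
  have hs : ∀ n k, (C.arcFree n (k + 1) : ℚ) = C.countReduced n (k + 1) +
      ∑ c ∈ range n, ∑ d ∈ range (c - 1), (C.arcFree (d + 1) k : ℚ) := by
    intro n k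
    rw [C.arcFree_eq, Nat.cast_add, Nat.cast_sum, add_right_inj]
    refine sum_congr rfl fun c hc => ?_
    rw [Nat.cast_sum]
    refine sum_congr rfl fun d hd => ?_
    rw [mem_range] at hc hd
    rw [hC.wrapping_succ k (by omega) (by omega) hc, show c - (c - (d + 1)) = d + 1 by omega]
  -- Since `0 < b < c < n`, wrapping arcs need `n ≥ 3`; smaller sizes are treated separately.
  have hs0 : ∀ k, (C.arcFree 0 (k + 1) : ℚ) = C.countReduced 0 (k + 1) := by simp [hs]
  have hs1 : ∀ k, (C.arcFree 1 (k + 1) : ℚ) = C.countReduced 1 (k + 1) := by simp [hs]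
  have hs2 : ∀ k, (C.arcFree 2 (k + 1) : ℚ) = C.countReduced 2 (k + 1) := by
    simp [hs, sum_range_succ]
  have hd : ∀ n k, (C.arcFree (n + 3) (k + 1) - 2 * C.arcFree (n + 2) (k + 1)
      + C.arcFree (n + 1) (k + 1) : ℚ) = C.countReduced (n + 3) (k + 1)
        - 2 * C.countReduced (n + 2) (k + 1) + C.countReduced (n + 1) (k + 1)
        + C.arcFree (n + 1) k := by
    intro n k
    rw [hs, hs, hs]
    linear_combination sum_sum_wrapping_second_difference (fun n => (C.arcFree n k : ℚ)) n
  have hε : ∀ n k, cf (if (1 : Equiv.Perm (Fin 0)) ∈ C 0 then 1 else 0) n k =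
      if n = 0 then (C.arcFree 0 k : ℚ) else 0 := by
    intro n k
    rw [C.arcFree_zero_size, C.count_zero_size]
    by_cases h : (1 : Equiv.Perm (Fin 0)) ∈ C 0 <;> by_cases hn : n = 0 <;>
      simp [h, hn, cf_one, show cf 0 n k = 0 from map_zero _, show cf 0 0 k = 0 from map_zero _]
  generalize (if (1 : Equiv.Perm (Fin 0)) ∈ C 0 then 1 else 0 : MvPowerSeries (Fin 2) ℚ) = ε
    at hε ⊢
  suffices H : genFun C.countReduced - x * genFun C.countReduced - x * genFun C.countReduced
      + x * (x * genFun C.countReduced) =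
      genFun C.arcFree - x * genFun C.arcFree - x * genFun C.arcFree + x * (x * genFun C.arcFree)
      - x * (x * (y * (genFun C.arcFree - ε))) by
    rw [PermClass.R]
    linear_combination H
  apply cf_ext
  intro n k
  rcases n with _ | _ | _ | n <;> rcases k with _ | k <;>
    simp only [cf_add, cf_sub, cf_x_mul_zero, cf_x_mul_succ, cf_y_mul_zero, cf_y_mul_succ,
      cf_genFun, hε, h0, hs0, hs1, hs2]
  all_goals simp
  all_goals linear_combination -hd n k

end TrivialCycles

/-! ### Noncrossing partitions and the equation for `D` -/

namespace TrivialCycles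

open Finset

/-- An equivalence relation on `{0, …, n - 1}` whose classes do not cross. -/
def NoncrossingRel {n : ℕ} (r : Setoid (Fin n)) : Prop :=
  ∀ a b a' b', a < b → b < a' → a' < b' → r a a' → r b b' → r a b

/-- The interval `[i, j)` is a class of `r`. -/
def IsBlock {n : ℕ} (r : Setoid (Fin n)) (i j : ℕ) : Prop :=
  ∀ k k' : Fin n, i ≤ k → (k : ℕ) < j → (r k k' ↔ i ≤ k' ∧ (k' : ℕ) < j)

/-- The equivalence relation that has `[a, a + l)` as a class and is given by `r` elsewhere. -/
noncomputable def glueRel {m a : ℕ} (l : ℕ) (ha : a ≤ m) (r : Setoid (Fin m)) : Setoid (Fin (m + l)) :=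
  Setoid.ker fun k => Sum.elim (fun i => some (Quotient.mk r i)) (fun _ => none)
    ((gapEquiv l ha).symm k)

section glue

variable {m a l : ℕ} (ha : a ≤ m) (r : Setoid (Fin m))

theorem gapEquiv_symm_skip (i : Fin m) : (gapEquiv l ha).symm (skip m l a i) = Sum.inl i :=
  (gapEquiv l ha).symm_apply_apply (Sum.inl i)

theorem gapEquiv_symm_block (i : Fin l) : (gapEquiv l ha).symm (block l ha i) = Sum.inr i :=
  (gapEquiv l ha).symm_apply_apply (Sum.inr i)

theorem glueRel_skip_skip (i j : Fin m) :
    glueRel l ha r (skip m l a i) (skip m l a j) ↔ r i j := by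
  rw [glueRel, Setoid.ker_def, gapEquiv_symm_skip, gapEquiv_symm_skip, Sum.elim_inl, Sum.elim_inl,
    Option.some_inj, Quotient.eq]

theorem glueRel_block_block (i j : Fin l) : glueRel l ha r (block l ha i) (block l ha j) := by
  rw [glueRel, Setoid.ker_def, gapEquiv_symm_block, gapEquiv_symm_block, Sum.elim_inr, Sum.elim_inr]

theorem not_glueRel_skip_block (i : Fin m) (j : Fin l) :
    ¬ glueRel l ha r (skip m l a i) (block l ha j) := by
  rw [glueRel, Setoid.ker_def, gapEquiv_symm_skip, gapEquiv_symm_block, Sum.elim_inr, Sum.elim_inl]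
  exact Option.some_ne_none _

theorem not_glueRel_block_skip (i : Fin m) (j : Fin l) :
    ¬ glueRel l ha r (block l ha j) (skip m l a i) :=
  fun h => not_glueRel_skip_block ha r i j (Setoid.symm' _ h)

theorem card_quotient_glueRel (hl : 0 < l) :
    Nat.card (Quotient (glueRel l ha r)) = Nat.card (Quotient r) + 1 := by
  rw [card_quotient_sum (gapEquiv l ha) (glueRel l ha r) r ⊤ (glueRel_skip_skip ha r)
    (fun i j => iff_of_true (glueRel_block_block ha r i j) trivial) (not_glueRel_skip_block ha r)]
  congr 1
  rw [Nat.card_eq_one_iff_unique]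
  refine ⟨⟨fun i j => ?_⟩, ⟨Quotient.mk _ ⟨0, hl⟩⟩⟩
  induction i using Quotient.inductionOn with | _ i =>
  induction j using Quotient.inductionOn with | _ j =>
  exact Quotient.sound trivial

theorem isBlock_glueRel : IsBlock (glueRel l ha r) a (a + l) := by
  intro k k' h1 h2
  obtain ⟨k, rfl⟩ | ⟨k, rfl⟩ := skip_or_block ha k
  · rw [val_skip] at h1 h2
    split_ifs at h1 h2 <;> omega
  · obtain ⟨k', rfl⟩ | ⟨k', rfl⟩ := skip_or_block ha k'
    · refine iff_of_false (not_glueRel_block_skip ha r _ _) ?_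
      rw [val_skip]
      split_ifs <;> omega
    · refine iff_of_true (glueRel_block_block ha r _ _) ?_
      rw [val_block]
      omega

theorem glueRel_comap_skip {r : Setoid (Fin (m + l))} (h : IsBlock r a (a + l)) :
    glueRel l ha (r.comap (skip m l a)) = r := by
  have hb : ∀ (i : Fin l) k, r (block l ha i) k ↔ a ≤ k ∧ (k : ℕ) < a + l := fun i k =>
    h _ _ (by rw [val_block]; omega) (by rw [val_block]; omega)
  have hbs : ∀ i j, ¬ r (block l ha i) (skip m l a j) := by
    intro i j hij
    rw [hb, val_skip] at hij
    split_ifs at hij <;> omega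
  ext k k'
  obtain ⟨k, rfl⟩ | ⟨k, rfl⟩ := skip_or_block ha k <;>
    obtain ⟨k', rfl⟩ | ⟨k', rfl⟩ := skip_or_block ha k'
  · exact glueRel_skip_skip ha _ k k'
  · exact iff_of_false (not_glueRel_skip_block ha _ _ _) fun h => hbs _ _ (r.symm' h)
  · exact iff_of_false (not_glueRel_block_skip ha _ _ _) (hbs _ _)
  · refine iff_of_true (glueRel_block_block ha _ _ _) ((hb _ _).2 ?_)
    rw [val_block]
    omega

theorem glueRel_injective : Function.Injective (glueRel (m := m) l ha) := by
  intro r s h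
  ext i j
  rw [← glueRel_skip_skip (l := l) ha r, h, glueRel_skip_skip]

theorem noncrossingRel_comap_skip {r : Setoid (Fin (m + l))} (h : NoncrossingRel r) :
    NoncrossingRel (r.comap (skip m l a)) := fun _ _ _ _ h1 h2 h3 =>
  h _ _ _ _ (skip_strictMono h1) (skip_strictMono h2) (skip_strictMono h3)

/-- In a mixed configuration one pair lies in the inserted interval and the other outside, but no
outside point separates two points of an interval. -/
theorem noncrossingRel_glueRel {r : Setoid (Fin m)} (h : NoncrossingRel r) :
    NoncrossingRel (glueRel l ha r) := by
  intro i j i' j' h1 h2 h3 hi hj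
  obtain ⟨i, rfl⟩ | ⟨i, rfl⟩ := skip_or_block ha i <;>
    obtain ⟨i', rfl⟩ | ⟨i', rfl⟩ := skip_or_block ha i' <;>
    obtain ⟨j, rfl⟩ | ⟨j, rfl⟩ := skip_or_block ha j <;>
    obtain ⟨j', rfl⟩ | ⟨j', rfl⟩ := skip_or_block ha j' <;>
    first
      | exact absurd hi (not_glueRel_skip_block ha r _ _)
      | exact absurd hi (not_glueRel_block_skip ha r _ _)
      | exact absurd hj (not_glueRel_skip_block ha r _ _)
      | exact absurd hj (not_glueRel_block_skip ha r _ _)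
      | exact glueRel_block_block ha r _ _
      | skip
  · rw [glueRel_skip_skip] at hi hj ⊢
    exact h i j i' j' (skip_strictMono.lt_iff_lt.1 h1) (skip_strictMono.lt_iff_lt.1 h2)
      (skip_strictMono.lt_iff_lt.1 h3) hi hj
  · rw [Fin.lt_def, val_skip, val_block] at h1 h2 h3
    split_ifs at h1 h2 h3 <;> omega
  · rw [Fin.lt_def, val_skip, val_block] at h1 h2
    split_ifs at h1 h2 <;> omega

theorem isBlock_glueRel_iff_of_le (r : Setoid (Fin m)) {i j : ℕ} (hj : j ≤ a) :
    IsBlock (glueRel l ha r) i j ↔ IsBlock r i j := by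
  constructor
  · intro h k k' hk1 hk2
    have hk : (skip m l a k : ℕ) = k := by rw [val_skip, if_pos (by omega)]
    rw [← glueRel_skip_skip (l := l) ha r, h _ _ (by omega) (by omega), val_skip]
    split_ifs <;> omega
  · intro h k k' hk1 hk2
    obtain ⟨k, rfl⟩ | ⟨k, rfl⟩ := skip_or_block ha k
    · have hk : (skip m l a k : ℕ) = k := by
        rw [val_skip] at hk2 ⊢
        split_ifs at hk2 ⊢ <;> omega
      obtain ⟨k', rfl⟩ | ⟨k', rfl⟩ := skip_or_block ha k'
      · rw [glueRel_skip_skip, h _ _ (by omega) (by omega), val_skip]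
        split_ifs <;> omega
      · refine iff_of_false (not_glueRel_skip_block ha r _ _) ?_
        rw [val_block]
        omega
    · rw [val_block] at hk2
      omega

end glue

theorem arcFamily_noncrossingRel :
    ArcFamily (fun n => {r : Setoid (Fin n) // NoncrossingRel r})
      (fun _ r => Nat.card (Quotient r.1)) (fun _ r => IsBlock r.1) where
  finite n := by
    have : Finite (Setoid (Fin n)) := Finite.of_injective (fun r i j => r i j) fun r s h =>
      Setoid.ext fun i j => iff_of_eq (congrFun (congrFun h i) j)
    infer_instance
  unique := by
    intro n r a a' j hj ha ha' h h'
    have h1 := (h ⟨j - 1, by omega⟩ ⟨a, by omega⟩ (by simp only; omega) (by simp only; omega)).2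
      ⟨le_rfl, ha⟩
    have h2 := (h' ⟨j - 1, by omega⟩ ⟨a', by omega⟩ (by simp only; omega) (by simp only; omega)).2
      ⟨le_rfl, ha'⟩
    rw [h' _ _ (by simp only; omega) (by simp only; omega)] at h1
    rw [h _ _ (by simp only; omega) (by simp only; omega)] at h2
    exact le_antisymm h2.1 h1.1
  disjoint := by
    intro n r i j a b hij ha hjb hb h h'
    have h1 := (h' ⟨j - 1, by omega⟩ ⟨j, by omega⟩ (by simp only; omega) (by simp only; omega)).2
      ⟨ha.le, hjb⟩
    rw [h _ _ (by simp only; omega) (by simp only; omega)] at h1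
    exact lt_irrefl _ h1.2
  insert := by
    intro m a l ha
    refine ⟨fun r => ⟨glueRel (l + 1) ha r.1, noncrossingRel_glueRel ha r.2⟩, ?_, ?_, ?_, ?_⟩
    · intro r s h
      exact Subtype.ext (glueRel_injective ha (congrArg Subtype.val h))
    · intro r
      exact card_quotient_glueRel ha _ l.succ_pos
    · intro r
      constructor
      · intro h
        exact ⟨⟨r.1.comap (skip m (l + 1) a), noncrossingRel_comap_skip r.2⟩,
          Subtype.ext (glueRel_comap_skip ha h)⟩
      · rintro ⟨r, rfl⟩
        exact isBlock_glueRel ha r.1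
    · intro r i j hij hj
      exact isBlock_glueRel_iff_of_le ha _ hj

theorem exists_extremal_of_class {n : ℕ} (r : Setoid (Fin n)) (z : Fin n) :
    ∃ i j, r z i ∧ r z j ∧ ∀ k, r z k → i ≤ k ∧ k ≤ j := by
  classical
  have hne : (univ.filter fun k => r z k).Nonempty := ⟨z, by simp⟩
  obtain ⟨i, hi, hi'⟩ := exists_min_image _ id hne
  obtain ⟨j, hj, hj'⟩ := exists_max_image _ id hne
  simp only [mem_filter, mem_univ, true_and, id] at hi hi' hj hj'
  exact ⟨i, j, hi, hj, fun k hk => ⟨hi' k hk, hj' k hk⟩⟩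

/-- A noncrossing partition has a part which is an interval. -/
theorem NoncrossingRel.exists_isBlock {n : ℕ} {r : Setoid (Fin n)} (h : NoncrossingRel r)
    (z : Fin n) : ∃ i j, i < j ∧ j ≤ n ∧ IsBlock r i j := by
  -- Induction on the difference of the extremes of a class. If the class is not an interval,
  -- noncrossing traps the class of a missing point strictly between these extremes.
  suffices H : ∀ d : ℕ, ∀ i j : Fin n, (j : ℕ) - i = d → r i j → (∀ k, r i k → i ≤ k ∧ k ≤ j) →
      ∃ i j, i < j ∧ j ≤ n ∧ IsBlock r i j by
    obtain ⟨i, j, hi, hj, hij⟩ := exists_extremal_of_class r z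
    exact H _ i j rfl (r.trans' (r.symm' hi) hj) fun k hk => hij k (r.trans' hi hk)
  intro d
  induction d using Nat.strong_induction_on with
  | _ d ih =>
    intro i j hd hij hmin
    by_cases hall : ∀ k, i ≤ k → k ≤ j → r i k
    · refine ⟨i, j + 1, ?_, by omega, fun k k' hk1 hk2 => ?_⟩
      · have := Fin.le_def.1 (hmin j hij).1
        omega
      · have hk : r i k := hall k hk1 (Nat.lt_succ_iff.1 hk2)
        constructor
        · intro hkk'
          have := hmin k' (r.trans' hk hkk')
          exact ⟨this.1, Nat.lt_succ_iff.2 this.2⟩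
        · rintro ⟨h1, h2⟩
          exact r.trans' (r.symm' hk) (hall k' h1 (Nat.lt_succ_iff.1 h2))
    · push Not at hall
      obtain ⟨z, hz1, hz2, hz⟩ := hall
      obtain ⟨i', j', hi', hj', hij'⟩ := exists_extremal_of_class r z
      have hiz : i < z := lt_of_le_of_ne hz1 fun h => hz (h ▸ r.refl' i)
      have hzj : z < j := lt_of_le_of_ne hz2 fun h => hz (h ▸ hij)
      have h1 : i < i' := by
        refine lt_of_not_ge fun hle => ?_
        rcases hle.lt_or_eq with hlt | rfl
        · exact hz (r.symm' (r.trans' hi' (h i' i z j hlt hiz hzj (r.symm' hi') hij)))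
        · exact hz (r.symm' hi')
      have h2 : j' < j := by
        refine lt_of_not_ge fun hle => ?_
        rcases hle.lt_or_eq with hlt | rfl
        · exact hz (h i z j j' hiz hzj hlt hij hj')
        · exact hz (r.trans' hij (r.symm' hj'))
      have h3 := (hij' i' hi').2
      rw [Fin.lt_def] at h1 h2
      rw [Fin.le_def] at h3
      exact ih _ (by omega) i' j' rfl (r.trans' (r.symm' hi') hj')
        fun k hk => hij' k (r.trans' hi' hk)

/-- Every nonempty noncrossing partition has an interval part, so only the empty one is counted. -/
theorem genFun_noncrossingRel_arcFree :
    genFun (fun n k => arcFreeCount (X := fun n => {r : Setoid (Fin n) // NoncrossingRel r})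
      (fun _ r => Nat.card (Quotient r.1)) (fun _ r => IsBlock r.1) n n k) = 1 := by
  apply cf_ext
  intro n k
  rw [cf_genFun, cf_one]
  rcases n with _ | n
  · have hq : ∀ r : Setoid (Fin 0), Nat.card (Quotient r) = 0 := by
      intro r
      rw [Nat.card_eq_zero]
      left
      constructor
      intro i
      induction i using Quotient.inductionOn with | _ i => exact i.elim0
    split_ifs with h
    · obtain ⟨-, rfl⟩ := h
      rw [arcFreeCount, Nat.card_eq_one_iff_unique.2, Nat.cast_one]
      refine ⟨⟨fun r s => Subtype.ext (Subtype.ext (Setoid.ext fun i => i.elim0))⟩,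
        ⟨⟨⟨⊤, fun i => i.elim0⟩, hq _, fun i j hij hj => by omega⟩⟩⟩
    · rw [arcFreeCount, Nat.card_eq_zero.2, Nat.cast_zero]
      left
      constructor
      rintro ⟨r, hr, -⟩
      rw [hq] at hr
      exact h ⟨rfl, hr.symm⟩
  · rw [if_neg (by omega), arcFreeCount, Nat.card_eq_zero.2, Nat.cast_zero]
    left
    constructor
    rintro ⟨r, -, hr⟩
    obtain ⟨i, j, hij, hj, h⟩ := r.2.exists_isBlock 0
    exact hr i j hij hj h

theorem isNoncrossing_iff {n : ℕ} (P : Finpartition (univ : Finset (Fin n))) :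
    IsNoncrossing P ↔ NoncrossingRel (Setoid.ker P.part) := by
  constructor
  · intro h a b a' b' h1 h2 h3 ha hb
    rw [Setoid.ker_def] at ha hb ⊢
    by_contra hab
    refine h _ (P.part_mem.2 (mem_univ a)) _ (P.part_mem.2 (mem_univ b)) hab
      ⟨a, P.mem_part_self.2 (mem_univ a), b, P.mem_part_self.2 (mem_univ b), a', ?_, b', ?_,
        h1, h2, h3⟩
    · rw [ha]
      exact P.mem_part_self.2 (mem_univ a')
    · rw [hb]
      exact P.mem_part_self.2 (mem_univ b')
  · rintro h A hA B hB hAB ⟨a, ha, b, hb, a', ha', b', hb', h1, h2, h3⟩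
    have hab := h a b a' b' h1 h2 h3
      ((P.part_eq_of_mem hA ha).trans (P.part_eq_of_mem hA ha').symm)
      ((P.part_eq_of_mem hB hb).trans (P.part_eq_of_mem hB hb').symm)
    rw [Setoid.ker_def, P.part_eq_of_mem hA ha, P.part_eq_of_mem hB hb] at hab
    exact hAB hab

theorem coe_parts_eq_range_part {n : ℕ} (P : Finpartition (univ : Finset (Fin n))) :
    (P.parts : Set (Finset (Fin n))) = Set.range P.part := by
  ext A
  constructor
  · intro hA
    obtain ⟨a, ha⟩ := P.nonempty_of_mem_parts hA
    exact ⟨a, P.part_eq_of_mem hA ha⟩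
  · rintro ⟨a, rfl⟩
    exact P.part_mem.2 (mem_univ a)

theorem card_quotient_ker_part {n : ℕ} (P : Finpartition (univ : Finset (Fin n))) :
    Nat.card (Quotient (Setoid.ker P.part)) = P.parts.card := by
  rw [Nat.card_congr (Setoid.quotientKerEquivRange P.part), ← coe_parts_eq_range_part]
  simp

theorem ker_part_bijective (n : ℕ) :
    Function.Bijective fun P : Finpartition (univ : Finset (Fin n)) => Setoid.ker P.part := by
  classical
  have hmem : ∀ (P : Finpartition (univ : Finset (Fin n))) a b,
      a ∈ P.part b ↔ P.part a = P.part b :=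
    fun P a b => P.mem_part_iff_part_eq_part (mem_univ a) (mem_univ b)
  constructor
  · intro P Q h
    have hPQ : P.part = Q.part := by
      funext a
      ext b
      rw [hmem, hmem]
      exact Setoid.ext_iff.1 h b a
    apply Finpartition.ext
    rw [← coe_inj, coe_parts_eq_range_part, coe_parts_eq_range_part, hPQ]
  · intro r
    refine ⟨Finpartition.ofSetoid r, Setoid.ext fun a b => ?_⟩
    rw [Setoid.ker_def, ← hmem, Finpartition.mem_part_ofSetoid_iff_rel]
    exact ⟨r.symm', r.symm'⟩

theorem arcFreeCount_noncrossingRel_zero (n k : ℕ) :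
    arcFreeCount (X := fun n => {r : Setoid (Fin n) // NoncrossingRel r})
      (fun _ r => Nat.card (Quotient r.1)) (fun _ r => IsBlock r.1) n 0 k =
        countNoncrossing n k := by
  symm
  refine Nat.card_congr (Equiv.ofBijective (fun P => ⟨⟨Setoid.ker P.1.part,
    (isNoncrossing_iff _).1 P.2.1⟩, (card_quotient_ker_part _).trans P.2.2,
    fun i j hij hj => by omega⟩) ⟨?_, ?_⟩)
  · intro P Q h
    exact Subtype.ext ((ker_part_bijective n).1 (congrArg (fun u => u.1.1) h))
  · rintro ⟨⟨r, hr⟩, h, -⟩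
    obtain ⟨P, rfl⟩ := (ker_part_bijective n).2 r
    exact ⟨⟨P, (isNoncrossing_iff P).2 hr, (card_quotient_ker_part P).symm.trans h⟩, rfl⟩

/-- The functional equation of the generating function of noncrossing partitions. -/
theorem D_eq : D = 1 + x * D * (y + D - 1) := by
  -- For any solution `E`, peeling gives `E * 1 = D`; uniqueness of the solution is not needed.
  obtain ⟨E, hE⟩ := exists_eq_one_add_mul
  have h := arcFamily_noncrossingRel.mul_subst_genFun hE
  rw [genFun_noncrossingRel_arcFree, ← MvPowerSeries.substAlgHom_apply (hasSubst_x_mul E), map_one,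
    mul_one] at h
  simp only [arcFreeCount_noncrossingRel_zero] at h
  rwa [show E = D from h] at hE

end TrivialCycles

/-! ### Elimination of the arc-free series and the factor -/

namespace TrivialCycles

theorem PermClass.genFun_arcFreeCount_zero (C : PermClass) :
    genFun (fun n k => arcFreeCount (X := fun n => {π : Equiv.Perm (Fin n) // π ∈ C n})
      (fun _ π => numCycles π.1) (fun _ π => IsArc π.1) n 0 k) = C.P := by
  apply cf_ext
  intro n k
  rw [PermClass.P, cf_genFun, cf_genFun, Nat.cast_inj]
  exact Nat.card_congr ⟨fun z => ⟨z.1.1, z.1.2, z.2.1⟩, fun z => ⟨⟨z.1, z.2.1⟩, z.2.2,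
    fun i j hij hj => by omega⟩, fun z => rfl, fun z => rfl⟩

theorem PermClass.IsClosed.D_mul_subst_arcFree {C : PermClass} (hC : C.IsClosed) :
    D * substXD (genFun C.arcFree) = C.P := by
  rw [← C.genFun_arcFreeCount_zero]
  exact (arcFamily_permClass hC).mul_subst_genFun D_eq

open Classical in
/-- The relation between all and reduced members of a closed class, cleared of denominators. -/
theorem PermClass.IsClosed.one_sub_mul_substXD {C : PermClass} (hC : C.IsClosed) :
    (1 - x * D) * substXD C.R = C.P * (1 + x - x * y - 2 * x * D) +
      x * D * (D - 1) * if (1 : Equiv.Perm (Fin 0)) ∈ C 0 then 1 else 0 := by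
  have h := congrArg (MvPowerSeries.substAlgHom (R := ℚ) (hasSubst_x_mul D)) hC.genFun_reduced
  have hP := hC.D_mul_subst_arcFree
  have hx : MvPowerSeries.substAlgHom (R := ℚ) (hasSubst_x_mul D) x = x * D :=
    MvPowerSeries.substAlgHom_X (hasSubst_x_mul D) 0
  have hy : MvPowerSeries.substAlgHom (R := ℚ) (hasSubst_x_mul D) y = y :=
    MvPowerSeries.substAlgHom_X (hasSubst_x_mul D) 1
  have hε : MvPowerSeries.substAlgHom (R := ℚ) (hasSubst_x_mul D)
      (if (1 : Equiv.Perm (Fin 0)) ∈ C 0 then 1 else 0) =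
        if (1 : Equiv.Perm (Fin 0)) ∈ C 0 then 1 else 0 := by
    split_ifs <;> simp only [map_one, map_zero]
  simp only [map_mul, map_sub, map_pow, map_one, hx, hy, hε] at h
  rw [MvPowerSeries.substAlgHom_apply, MvPowerSeries.substAlgHom_apply] at h
  change (1 - x * D) ^ 2 * substXD C.R = (1 - x * D) ^ 2 * substXD (genFun C.arcFree) -
    (x * D) ^ 2 * y * (substXD (genFun C.arcFree) - _) at h
  have hD := D_eq
  have hD0 : D ≠ 0 := by
    intro h0
    rw [h0] at hD
    simp at hD
  -- With `X = xD`, the equation of `D` reads `Xy = (D - 1)(1 - X)`. Hence `(1 - X)² - X²y = (1 -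
  -- X)(1 - XD)`, and `1 - XD = D (1 + x - xy - 2xD)`; the common factor `1 - X` cancels.
  apply mul_left_cancel₀ hD0
  apply mul_left_cancel₀ (one_sub_x_mul_ne_zero D)
  generalize (if (1 : Equiv.Perm (Fin 0)) ∈ C 0 then 1 else 0 : MvPowerSeries (Fin 2) ℚ) = ε
    at h ⊢
  generalize substXD (genFun C.arcFree) = V at h hP
  generalize substXD C.R = R at h ⊢
  rw [← hP]
  linear_combination D * h + (D * V * (2 * x * D - 1) - x * D ^ 2 * ε) * hD

theorem constantCoeff_D : MvPowerSeries.constantCoeff D = 1 := by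
  rw [D_eq]
  simp

/-- The functional equation differentiated with respect to `x`. -/
theorem pderiv_D_mul :
    MvPowerSeries.pderiv ℚ 0 D * (1 + x - x * y - 2 * x * D) = D * (D - 1 + y) := by
  have h := congrArg (MvPowerSeries.pderiv ℚ 0) D_eq
  have hx : MvPowerSeries.pderiv ℚ 0 x = 1 := by simp
  have hy : MvPowerSeries.pderiv ℚ 0 y = 0 := by simp
  simp only [map_add, map_sub, Derivation.leibniz, Derivation.map_one_eq_zero, hx, hy,
    smul_eq_mul] at h
  linear_combination h

theorem sqrt_mul_inv_cancel :
    (1 + x - x * y - 2 * x * D) * (1 + x - x * y - 2 * x * D)⁻¹ = 1 :=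
  MvPowerSeries.mul_inv_cancel _ (by simp)

/-- With `S = 1 + x - xy - 2xD`, the derivative formula gives `1 + x(D - 1 + y) / S`, and `S + x(D -
1 + y) = 1 - xD`. -/
theorem factor_eq : factor = (1 - x * D) * (1 + x - x * y - 2 * x * D)⁻¹ := by
  have hS := sqrt_mul_inv_cancel
  have hD := MvPowerSeries.mul_inv_cancel D (by simp [constantCoeff_D])
  have hpd := pderiv_D_mul
  rw [factor]
  generalize (1 + x - x * y - 2 * x * D)⁻¹ = T at *
  generalize D⁻¹ = U at *
  generalize MvPowerSeries.pderiv ℚ 0 D = D' at *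
  linear_combination -(1 + x * D' * U) * hS + T * x * U * hpd + T * x * (D - 1 + y) * hD

end TrivialCycles

theorem theorem4p1 (C : TrivialCycles.PermClass) (hC : C.IsClosed) :
    ∃ S : MvPowerSeries (Fin 2) ℚ,
      -- `S = √((x + x y - 1)² - 4 x² y)`
      TrivialCycles.IsFormalSqrt S
        ((TrivialCycles.x + TrivialCycles.x * TrivialCycles.y - 1) ^ 2
          - 4 * TrivialCycles.x ^ 2 * TrivialCycles.y) ∧
      -- `D = (1 - x - x y - S) / (2 x) + 1`
      2 * TrivialCycles.x * (TrivialCycles.D - 1) =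
        1 - TrivialCycles.x - TrivialCycles.x * TrivialCycles.y - S ∧
      -- the two forms of the factor agree
      TrivialCycles.factor = (1 - TrivialCycles.x * TrivialCycles.D) * S⁻¹ ∧
      -- classes without the empty permutation
      ((1 : Equiv.Perm (Fin 0)) ∉ C 0 →
        C.P = TrivialCycles.substXD C.R * TrivialCycles.factor ∧
        C.P = TrivialCycles.substXD C.R * ((1 - TrivialCycles.x * TrivialCycles.D) * S⁻¹)) ∧
      -- classes with the empty permutation
      ((1 : Equiv.Perm (Fin 0)) ∈ C 0 →
        C.P = TrivialCycles.D + (TrivialCycles.substXD C.R - 1) * TrivialCycles.factor ∧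
        C.P = TrivialCycles.D + (TrivialCycles.substXD C.R - 1) *
          ((1 - TrivialCycles.x * TrivialCycles.D) * S⁻¹)) := by
  open TrivialCycles in
  have hS := sqrt_mul_inv_cancel
  have hkey := hC.one_sub_mul_substXD
  -- The functional equation is quadratic in `D`; this is minus the derivative of `xD² + (xy - x -
  -- 1)D + 1` in `D`, so its square is the discriminant.
  refine ⟨1 + x - x * y - 2 * x * D, ⟨by simp, ?_⟩, by ring, factor_eq, ?_, ?_⟩
  · linear_combination -4 * x * D_eq
  · intro h
    rw [factor_eq, and_self]
    rw [if_neg h] at hkey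
    generalize (1 + x - x * y - 2 * x * D)⁻¹ = T at *
    linear_combination -C.P * hS - T * hkey
  · intro h
    rw [factor_eq, and_self]
    rw [if_pos h] at hkey
    generalize (1 + x - x * y - 2 * x * D)⁻¹ = T at *
    -- Subtracting `1 - xD` from `hkey` leaves `P S - (1 - xD²) = (P - D) S` on the right.
    linear_combination (D - C.P) * hS - T * hkey - T * D_eq
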